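/- Let $\{Z_n\}_{n\ge1}$ be a sequence of i.i.d. standard Gaussian random variables $N(0,1)$, and let $\{a_n\}_{n\ge1}$, $\{b_n\}_{n\ge1}$ be two non-increasing sequences of positive real numbers with $\sum_{n=1}^\infty a_n<\infty$ and $\sum_{n=1}^\infty b_n<\infty$. Write $\|a\|_2=\big(\sum_{n=1}^\infty a_n^2\big)^{1/2}$ and $\|b\|_2=\big(\sum_{n=1}^\infty b_n^2\big)^{1/2}$. Suppose that the infinite products $$\prod_{n=1}^{\infty}\left(2-\frac{a_n/\|a\|_2}{b_n/\|b\|_2}\right)\quad\text{and}\quad\prod_{n=1}^{\infty}\left(2-\frac{b_n/\|b\|_2}{a_n/\|a\|_2}\right)$$ both converge, where $\prod_{n=1}^\infty u_n$ is said to converge if for some $N$ the partial products $\prod_{n=N}^{m}u_n$ tend to a finite nonzero limit as $m\to\infty$ (convergence need not be absolute). Then $$\mathbb{P}\left\{\sum_{n=1}^{\infty}a_n|Z_n|\ge r\|a\|_2\right\}\sim\mathbb{P}\left\{\sum_{n=1}^{\infty}b_n|Z_n|\ge r\|b\|_2\right\}\qquad\text{as } r\to\infty,$$ that is, the ratio of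 the two probabilities tends to $1$. -/

import Mathlib

open scoped Asymptotics

/-- The `ℓ²` norm of a real sequence. -/
noncomputable def l2Norm (a : ℕ → ℝ) : ℝ := √(∑' n, a n ^ 2)

/-- Convergence of the infinite product `∏ u n` in the standard sense (ordered, possibly
conditional): from some index `N` on, the partial products tend to a nonzero finite limit.
Finitely many factors may vanish; a product whose partial products tend to `0` without that
is divergent. -/
def InfiniteProductConverges (u : ℕ → ℝ) : Prop :=
  ∃ N : ℕ, ∃ p : ℝ, p ≠ 0 ∧
    Filter.Tendsto (fun m => ∏ k ∈ Finset.range m, u (N + k)) Filter.atTop (nhds p)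

/-- The upper tail `r ↦ P{∑ aₙ |Zₙ| ≥ r ‖a‖₂}`. The series of nonnegative terms is summed
in `[0, ∞]`, so that it has its proper value at every sample point. -/
noncomputable def upperTail {Ω : Type*} [MeasurableSpace Ω] (P : MeasureTheory.Measure Ω)
    (Z : ℕ → Ω → ℝ) (a : ℕ → ℝ) (r : ℝ) : ℝ :=
  P.real {ω | ENNReal.ofReal (r * l2Norm a) ≤ ∑' n, ENNReal.ofReal (a n * |Z n ω|)}

open MeasureTheory Filter Topology Real ProbabilityTheory
open scoped NNReal

/-! Write α and β for the two sequences divided by their ℓ² norms. The proof finds the exact tail: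
for ∑ αₙ² = 1, P{∑ αₙ|Zₙ| ≥ r} ~ exp(-r²/2)/(r√(2π)) · ∏ 2Φ(rαₙ) (`tendsto_tail_div`). It then shows
that the product for α over the product for β tends to 1 (`tendsto_logProdTwoPhi_sub`).

Exact tail. Replace |Zₙ| by Zₙ for n < k. By reflection, each replacement halves the tail up to an
exponentially smaller error, while the dropped factor 2Φ(rαₙ) tends to 2; so the ratio of tail to
prediction is asymptotically the same for every k. For large k the Gaussian part has variance v near
1 and is independent of the remainder R. Tilting by r bounds the tail in terms of the moment
generating function of R, an explicit product, with constants tending to 1 as k → ∞.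

Comparison of products. With αₙ = βₙ(1+εₙ), the hypotheses amount to convergence of ∑ εₙ, possibly
conditional, together with ∑ εₙ² < ∞ (`summable_of_infiniteProductConverges`). To first order, the
logarithms differ by ∑ εₙ h(rβₙ), where h(x) = x (log 2Φ)'(x) has bounded variation on [0, ∞). As β
is monotone, n ↦ h(rβₙ) has variation bounded uniformly in r, and Abel summation controls the tail
of the sum. The second-order terms are O(εₙ²), uniformly in r, and each fixed term tends to log 2 -
log 2. -/

/-! ### The function 2Φ, its logarithm and the inverse Mills ratio. -/

/-- Twice the standard normal distribution function, `x ↦ 2 Φ(x)`. -/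
noncomputable def twoPhi (x : ℝ) : ℝ := 1 + √(2 / π) * ∫ t in (0 : ℝ)..x, exp (-t ^ 2 / 2)

theorem sqrt_two_div_pi_le_one : √(2 / π) ≤ 1 := by
  rw [Real.sqrt_le_one, div_le_one pi_pos]
  linarith [pi_gt_three]

theorem hasDerivAt_twoPhi (x : ℝ) :
    HasDerivAt twoPhi (√(2 / π) * exp (-x ^ 2 / 2)) x := by
  have hc : Continuous fun t : ℝ => exp (-t ^ 2 / 2) := by fun_prop
  have h := intervalIntegral.integral_hasDerivAt_right (hc.intervalIntegrable 0 x)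
    (hc.stronglyMeasurableAtFilter _ _) hc.continuousAt
  exact (h.const_mul _).const_add 1

theorem monotone_twoPhi : Monotone twoPhi :=
  monotone_of_hasDerivAt_nonneg hasDerivAt_twoPhi fun _ => by positivity

theorem twoPhi_zero : twoPhi 0 = 1 := by simp [twoPhi]

theorem one_le_twoPhi {x : ℝ} (hx : 0 ≤ x) : 1 ≤ twoPhi x :=
  twoPhi_zero ▸ monotone_twoPhi hx

theorem tendsto_twoPhi_atTop : Tendsto twoPhi atTop (𝓝 2) := by
  have hI : Integrable fun t : ℝ => exp (-(1 / 2) * t ^ 2) := integrable_exp_neg_mul_sq (by norm_num)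
  have h := intervalIntegral_tendsto_integral_Ioi 0 hI.integrableOn tendsto_id
  rw [integral_gaussian_Ioi] at h
  have h2 := (h.const_mul √(2 / π)).const_add 1
  have e : 1 + √(2 / π) * (√(π / (1 / 2)) / 2) = 2 := by
    have : √(2 / π) * √(π / (1 / 2)) = 2 := by
      rw [← Real.sqrt_mul (by positivity)]
      have : (2 / π * (π / (1 / 2)) : ℝ) = 2 ^ 2 := by field_simp
      rw [this, Real.sqrt_sq (by norm_num)]
    linarith
  rw [e] at h2
  refine h2.congr fun x => ?_
  simp only [twoPhi, id]
  congr 2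
  refine intervalIntegral.integral_congr fun t _ => ?_
  ring_nf

/-- The logarithm of `2 Φ`. -/
noncomputable def logTwoPhi (x : ℝ) : ℝ := log (twoPhi x)

/-- The derivative of `log (2 Φ)` on the positive half-line, the inverse Mills ratio. -/
noncomputable def invMills (x : ℝ) : ℝ := √(2 / π) * exp (-x ^ 2 / 2) / twoPhi x

theorem logTwoPhi_zero : logTwoPhi 0 = 0 := by simp [logTwoPhi, twoPhi_zero]

theorem logTwoPhi_nonneg {x : ℝ} (hx : 0 ≤ x) : 0 ≤ logTwoPhi x := log_nonneg (one_le_twoPhi hx)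

theorem exp_logTwoPhi {x : ℝ} (hx : 0 ≤ x) : exp (logTwoPhi x) = twoPhi x :=
  exp_log (by linarith [one_le_twoPhi hx])

theorem logTwoPhi_mono {x y : ℝ} (hx : 0 ≤ x) (hxy : x ≤ y) : logTwoPhi x ≤ logTwoPhi y :=
  log_le_log (by linarith [one_le_twoPhi hx]) (monotone_twoPhi hxy)

theorem tendsto_logTwoPhi_atTop : Tendsto logTwoPhi atTop (𝓝 (log 2)) :=
  tendsto_twoPhi_atTop.log (by norm_num)

theorem hasDerivAt_logTwoPhi {x : ℝ} (hx : 0 ≤ x) : HasDerivAt logTwoPhi (invMills x) x :=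
  (hasDerivAt_twoPhi x).log (by linarith [one_le_twoPhi hx])

theorem invMills_nonneg {x : ℝ} (hx : 0 ≤ x) : 0 ≤ invMills x := by
  have := one_le_twoPhi hx
  unfold invMills
  positivity

theorem invMills_le_exp {x : ℝ} (hx : 0 ≤ x) : invMills x ≤ exp (-x ^ 2 / 2) := by
  have h1 := one_le_twoPhi hx
  unfold invMills
  rw [div_le_iff₀ (by linarith)]
  have h2 := sqrt_two_div_pi_le_one
  have h3 := exp_pos (-x ^ 2 / 2)
  nlinarith

theorem invMills_le_one {x : ℝ} (hx : 0 ≤ x) : invMills x ≤ 1 :=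
  (invMills_le_exp hx).trans (exp_le_one_iff.2 (by nlinarith [sq_nonneg x]))

theorem hasDerivAt_invMills {x : ℝ} (hx : 0 ≤ x) :
    HasDerivAt invMills (-(invMills x * (x + invMills x))) x := by
  have h1 := one_le_twoPhi hx
  have h2 : HasDerivAt (fun x : ℝ => √(2 / π) * exp (-x ^ 2 / 2))
      (√(2 / π) * (exp (-x ^ 2 / 2) * (-x))) x := by
    have h0 : HasDerivAt (fun x : ℝ => -x ^ 2 / 2) (-x) x := by
      refine (((hasDerivAt_pow 2 x).neg).div_const 2).congr_deriv ?_
      norm_num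
      ring
    exact (h0.exp).const_mul _
  refine (h2.div (hasDerivAt_twoPhi x) (by linarith)).congr_deriv ?_
  unfold invMills
  field_simp
  ring

theorem logTwoPhi_sub_le {x y : ℝ} (hx : 0 ≤ x) (hxy : x ≤ y) :
    logTwoPhi y - logTwoPhi x ≤ y - x := by
  have := Convex.norm_image_sub_le_of_norm_hasDerivWithin_le (f := logTwoPhi) (f' := invMills)
    (C := 1) (s := Set.Ici 0) (x := x) (y := y)
    (fun z hz => (hasDerivAt_logTwoPhi hz).hasDerivWithinAt)
    (fun z hz => by
      rw [Real.norm_of_nonneg (invMills_nonneg hz)]; exact invMills_le_one hz)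
    (convex_Ici 0) hx (hx.trans hxy)
  rw [one_mul, Real.norm_eq_abs, Real.norm_eq_abs, abs_of_nonneg (sub_nonneg.2 hxy)] at this
  exact (le_abs_self _).trans this

theorem logTwoPhi_le {x : ℝ} (hx : 0 ≤ x) : logTwoPhi x ≤ x := by
  simpa [logTwoPhi_zero] using logTwoPhi_sub_le le_rfl hx

/-! ### Exponential moments of the half-normal law. -/

theorem integrable_exp_mul_abs_gaussian (x : ℝ) :
    Integrable (fun z => exp (x * |z|)) (ProbabilityTheory.gaussianReal 0 1) := by
  have h : ∀ c : ℝ, Integrable (fun z => exp (c * z)) (ProbabilityTheory.gaussianReal 0 1) :=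
    fun c => ProbabilityTheory.integrable_exp_mul_gaussianReal c
  refine Integrable.mono' ((h x).add (h (-x))) (by fun_prop) (ae_of_all _ fun z => ?_)
  rw [Real.norm_of_nonneg (exp_pos _).le]
  simp only [Pi.add_apply]
  rcases abs_cases z with ⟨h, _⟩ | ⟨h, _⟩ <;> rw [h]
  · linarith [exp_pos (-x * z)]
  · rw [show x * -z = -x * z by ring]; linarith [exp_pos (x * z)]

/-- The moment generating function of the half-normal distribution. -/
theorem integral_exp_mul_abs_gaussian (x : ℝ) :
    ∫ z, exp (x * |z|) ∂(ProbabilityTheory.gaussianReal 0 1) = exp (x ^ 2 / 2) * twoPhi x := by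
  have hI : Integrable fun t : ℝ => exp (-(1 / 2) * t ^ 2) := integrable_exp_neg_mul_sq (by norm_num)
  have hI' : Integrable fun t : ℝ => exp (-t ^ 2 / 2) := by
    refine hI.congr (ae_of_all _ fun t => ?_); simp only; ring_nf
  have hhalf : ∫ t in Set.Ioi (0 : ℝ), exp (-t ^ 2 / 2) = √(2 * π) / 2 := by
    rw [show √(2 * π) / 2 = √(π / (1 / 2)) / 2 by congr 2; ring, ← integral_gaussian_Ioi]
    refine integral_congr_ae (ae_of_all _ fun t => ?_); simp only; ring_nf
  have hneg : ∫ t in (-x)..0, exp (-t ^ 2 / 2) = ∫ t in (0 : ℝ)..x, exp (-t ^ 2 / 2) := by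
    have := intervalIntegral.integral_comp_neg (a := -x) (b := 0)
      (fun t : ℝ => exp (-t ^ 2 / 2))
    simp only [neg_sq, neg_neg, neg_zero] at this
    exact this
  have hsplit : ∫ t in Set.Ioi (-x), exp (-t ^ 2 / 2)
      = √(2 * π) / 2 + ∫ t in (0 : ℝ)..x, exp (-t ^ 2 / 2) := by
    have := intervalIntegral.integral_Ioi_sub_Ioi' (μ := volume) (a := -x) (b := 0)
      hI'.integrableOn hI'.integrableOn
    rw [hneg, hhalf] at this
    linarith
  rw [ProbabilityTheory.integral_gaussianReal_eq_integral_smul one_ne_zero]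
  -- Completing the square in |z| makes the integrand even, so the integral folds onto the
  -- half-line.
  have e1 : ∀ z : ℝ, ProbabilityTheory.gaussianPDFReal 0 1 z • exp (x * |z|)
      = (fun u : ℝ => exp (x ^ 2 / 2) * (√(2 * π))⁻¹ * exp (-(u + (-x)) ^ 2 / 2)) |z| := by
    intro z
    simp only [ProbabilityTheory.gaussianPDFReal, smul_eq_mul, NNReal.coe_one, mul_one, sub_zero]
    have : exp (-z ^ 2 / 2) * exp (x * |z|) = exp (x ^ 2 / 2) * exp (-(|z| + (-x)) ^ 2 / 2) := by
      rw [← exp_add, ← exp_add]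
      congr 1
      rw [← sq_abs z]; ring
    rw [mul_assoc, this]; ring
  rw [integral_congr_ae (ae_of_all _ e1), integral_comp_abs
    (f := fun u : ℝ => exp (x ^ 2 / 2) * (√(2 * π))⁻¹ * exp (-(u + (-x)) ^ 2 / 2)),
    integral_const_mul]
  have e2 : ∫ u in Set.Ioi (0 : ℝ), exp (-(u + (-x)) ^ 2 / 2)
      = ∫ t in Set.Ioi (-x), exp (-t ^ 2 / 2) := by
    have := (measurePreserving_add_right volume (-x)).setIntegral_preimage_emb
      (measurableEmbedding_addRight (-x)) (fun t : ℝ => exp (-t ^ 2 / 2)) (Set.Ioi (-x))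
    rwa [show (fun u => u + -x) ⁻¹' Set.Ioi (-x) = Set.Ioi (0 : ℝ) by ext u; simp] at this
  rw [e2, hsplit]
  unfold twoPhi
  have e3 : √(2 / π) = 2 * (√(2 * π))⁻¹ := by
    rw [← div_eq_mul_inv, eq_div_iff (by positivity), ← Real.sqrt_mul (by positivity),
      show (2 / π * (2 * π) : ℝ) = 2 ^ 2 by field_simp, Real.sqrt_sq (by norm_num)]
  rw [e3]
  have : √(2 * π) ≠ 0 := by positivity
  field_simp

/-! ### Decay and variation of the inverse Mills ratio. -/

theorem exp_neg_sq_half_mul_le (x : ℝ) : exp (-x ^ 2 / 2) * (1 + x ^ 2 / 2 + x ^ 4 / 8) ≤ 1 := by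
  have h := quadratic_le_exp_of_nonneg (x := x ^ 2 / 2) (by positivity)
  rw [show -x ^ 2 / 2 = -(x ^ 2 / 2) by ring, exp_neg, inv_mul_le_one₀ (exp_pos _)]
  calc _ = 1 + x ^ 2 / 2 + (x ^ 2 / 2) ^ 2 / 2 := by ring
    _ ≤ _ := h

/-- Since `invMills` has derivative -q(x + q), this is a scale-invariant bound |q'(x)| ≤ 16/x²,
which makes the Taylor error below independent of x. -/
theorem invMills_deriv_le {x : ℝ} (hx : 0 ≤ x) :
    invMills x * (x + invMills x) * x ^ 2 ≤ 16 := by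
  have h0 := invMills_nonneg hx
  have h1 := invMills_le_one hx
  have h2 := invMills_le_exp hx
  have h3 := exp_neg_sq_half_mul_le x
  set e := exp (-x ^ 2 / 2)
  have he : 0 < e := exp_pos _
  set q := invMills x
  have hp : (x + 1) * x ^ 2 ≤ 16 * (1 + x ^ 2 / 2 + x ^ 4 / 8) := by
    nlinarith [sq_nonneg (x ^ 2 - x), sq_nonneg x, sq_nonneg (x - 1), sq_nonneg (x ^ 2)]
  calc q * (x + q) * x ^ 2 ≤ e * (x + 1) * x ^ 2 := by gcongr
    _ = e * ((x + 1) * x ^ 2) := by ring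
    _ ≤ e * (16 * (1 + x ^ 2 / 2 + x ^ 4 / 8)) := by gcongr
    _ ≤ 16 := by linarith

/-- The function `x ↦ x (log 2Φ)'(x)` has derivative dominated by that of `16 arctan`. -/
theorem abs_deriv_mul_invMills_le {x : ℝ} (hx : 0 ≤ x) :
    |invMills x - x * (invMills x * (x + invMills x))| ≤ 16 * (1 / (1 + x ^ 2)) := by
  have h0 := invMills_nonneg hx
  have h1 := invMills_le_one hx
  have h2 := invMills_le_exp hx
  have h3 := exp_neg_sq_half_mul_le x
  set e := exp (-x ^ 2 / 2)
  have he : 0 < e := exp_pos _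
  set q := invMills x
  have hb : |q - x * (q * (x + q))| ≤ e * (1 + x + x ^ 2) := by
    rw [show q - x * (q * (x + q)) = q * (1 - x * (x + q)) by ring, abs_mul, abs_of_nonneg h0]
    have : |1 - x * (x + q)| ≤ 1 + x + x ^ 2 := by
      rw [abs_le]; constructor <;> nlinarith [mul_nonneg hx h0, mul_le_mul_of_nonneg_left h1 hx]
    gcongr
  refine hb.trans ?_
  rw [mul_one_div, le_div_iff₀ (by positivity)]
  have hp : (1 + x + x ^ 2) * (1 + x ^ 2) ≤ 16 * (1 + x ^ 2 / 2 + x ^ 4 / 8) := by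
    nlinarith [sq_nonneg (x ^ 2 - x), sq_nonneg x, sq_nonneg (x - 1), sq_nonneg (x ^ 2)]
  calc e * (1 + x + x ^ 2) * (1 + x ^ 2) = e * ((1 + x + x ^ 2) * (1 + x ^ 2)) := by ring
    _ ≤ e * (16 * (1 + x ^ 2 / 2 + x ^ 4 / 8)) := by gcongr
    _ ≤ 16 := by linarith

/-- Integrating the derivative bound 16/(1 + x²). The right side is a difference of values of one
bounded monotone function, so it telescopes along a monotone sequence. -/
theorem abs_mul_invMills_sub_le {x y : ℝ} (hx : 0 ≤ x) (hxy : x ≤ y) :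
    |y * invMills y - x * invMills x| ≤ 16 * arctan y - 16 * arctan x := by
  have hd : ∀ z ∈ Set.Ici (0 : ℝ), HasDerivAt (fun z => z * invMills z)
      (invMills z - z * (invMills z * (z + invMills z))) z := fun z hz => by
    refine ((hasDerivAt_id z).mul (hasDerivAt_invMills hz)).congr_deriv ?_
    simp only [id]; ring
  have hat : ∀ z : ℝ, HasDerivAt (fun z => 16 * arctan z) (16 * (1 / (1 + z ^ 2))) z := fun z =>
    (hasDerivAt_arctan z).const_mul 16
  -- The signs σ = ±1 give the two halves of the absolute value.
  have key : ∀ σ : ℝ, |σ| = 1 →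
      MonotoneOn (fun z => 16 * arctan z - σ * (z * invMills z)) (Set.Ici 0) := fun σ hσ => by
    have hd' : ∀ z ∈ Set.Ici (0 : ℝ), HasDerivAt
        (fun z => 16 * arctan z - σ * (z * invMills z))
        (16 * (1 / (1 + z ^ 2)) - σ * (invMills z - z * (invMills z * (z + invMills z)))) z :=
      fun z hz => (hat z).sub ((hd z hz).const_mul σ)
    refine monotoneOn_of_hasDerivWithinAt_nonneg (convex_Ici 0)
      (fun z hz => (hd' z hz).continuousAt.continuousWithinAt)
      (fun z hz => (hd' z (interior_subset hz)).hasDerivWithinAt) fun z hz => ?_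
    have h := abs_deriv_mul_invMills_le (x := z) (interior_subset hz)
    have h' := le_abs_self (σ * (invMills z - z * (invMills z * (z + invMills z))))
    rw [abs_mul, hσ, one_mul] at h'
    linarith
  have h1 := key 1 (by norm_num) hx (hx.trans hxy) hxy
  have h2 := key (-1) (by norm_num) hx (hx.trans hxy) hxy
  simp only at h1 h2
  rw [abs_le]
  constructor <;> linarith

theorem mul_invMills_le {x : ℝ} (hx : 0 ≤ x) : |x * invMills x| ≤ 32 := by
  have h := abs_mul_invMills_sub_le le_rfl hx
  simp only [zero_mul, sub_zero, arctan_zero, mul_zero] at h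
  linarith [arctan_lt_pi_div_two x, pi_lt_four]

/-- First order expansion of `log 2Φ` under a relative perturbation of the argument. -/
theorem abs_logTwoPhi_taylor {x ε : ℝ} (hx : 0 < x) (hε : |ε| ≤ 1 / 2) :
    |logTwoPhi (x * (1 + ε)) - logTwoPhi x - ε * (x * invMills x)| ≤ 64 * ε ^ 2 := by
  obtain ⟨hε1, hε2⟩ := abs_le.1 hε
  set s := Set.uIcc x (x * (1 + ε)) with hs
  have hmem : ∀ z ∈ s, x / 2 ≤ z := fun z hz => by
    rw [hs, Set.mem_uIcc] at hz
    rcases hz with hz | hz <;> nlinarith [hz.1]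
  have hdist : ∀ z ∈ s, |z - x| ≤ x * |ε| := fun z hz => by
    have := Set.abs_sub_left_of_mem_uIcc hz
    rwa [show x * (1 + ε) - x = x * ε by ring, abs_mul, abs_of_pos hx] at this
  -- The segment stays above x/2, where |q'| ≤ 16/(x/2)² = 64/x².
  have hq : ∀ z ∈ s, |invMills z - invMills x| ≤ 64 / x ^ 2 * (x * |ε|) := fun z hz => by
    have := Convex.norm_image_sub_le_of_norm_hasDerivWithin_le (f := invMills)
      (f' := fun z => -(invMills z * (z + invMills z)))
      (C := 64 / x ^ 2) (s := s) (x := x) (y := z)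
      (fun y hy => (hasDerivAt_invMills (by linarith [hmem y hy])).hasDerivWithinAt)
      (fun y hy => by
        have hy2 := hmem y hy
        have hy0 : 0 ≤ y := by linarith
        have h0 := invMills_nonneg hy0
        have h1 := invMills_deriv_le hy0
        have h2 : 0 ≤ invMills y * (y + invMills y) := by positivity
        rw [norm_neg, Real.norm_of_nonneg h2, le_div_iff₀ (by positivity)]
        have : (x / 2) ^ 2 ≤ y ^ 2 := by gcongr
        nlinarith [mul_le_mul_of_nonneg_left this h2])
      (convex_uIcc _ _) Set.left_mem_uIcc hz
    refine this.trans ?_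
    have := hdist z hz
    rw [Real.norm_eq_abs]
    gcongr
  have := Convex.norm_image_sub_le_of_norm_hasDerivWithin_le
      (f := fun z => logTwoPhi z - invMills x * z) (f' := fun z => invMills z - invMills x)
      (C := 64 / x ^ 2 * (x * |ε|)) (s := s) (x := x) (y := x * (1 + ε))
      (fun y hy => ((hasDerivAt_logTwoPhi (by linarith [hmem y hy])).sub
        (((hasDerivAt_id y).const_mul (invMills x)).congr_deriv (mul_one _))).hasDerivWithinAt)
      hq (convex_uIcc _ _) Set.left_mem_uIcc Set.right_mem_uIcc
  rw [Real.norm_eq_abs, Real.norm_eq_abs, show x * (1 + ε) - x = x * ε by ring, abs_mul,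
    abs_of_pos hx] at this
  calc _ = |logTwoPhi (x * (1 + ε)) - invMills x * (x * (1 + ε))
        - (logTwoPhi x - invMills x * x)| := by congr 1; ring
    _ ≤ _ := this
    _ = 64 * |ε| ^ 2 := by field_simp
    _ = _ := by rw [sq_abs]

/-! ### Abel summation and comparison of the two products. -/

/-- Abel's summation bound, for weights of total variation controlled by an antitone sequence. -/
theorem abs_sum_mul_le_of_variation {ε h V : ℕ → ℝ} {η C : ℝ} (hη : 0 ≤ η)
    (hε : ∀ m, |∑ n ∈ Finset.range m, ε n| ≤ η) (hh : ∀ n, |h n| ≤ C)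
    (hV : ∀ n, |h (n + 1) - h n| ≤ V n - V (n + 1)) (m : ℕ) :
    |∑ n ∈ Finset.range m, ε n * h n| ≤ η * (C + (V 0 - V m)) := by
  -- With the boundary term moved to the left, induction on m is summation by parts.
  have key : |∑ n ∈ Finset.range m, ε n * h n - (∑ n ∈ Finset.range m, ε n) * h m|
      ≤ η * (V 0 - V m) := by
    induction m with
    | zero => simp
    | succ m ih =>
      have e : ∑ n ∈ Finset.range (m + 1), ε n * h n
          - (∑ n ∈ Finset.range (m + 1), ε n) * h (m + 1)
          = (∑ n ∈ Finset.range m, ε n * h n - (∑ n ∈ Finset.range m, ε n) * h m)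
            - (∑ n ∈ Finset.range (m + 1), ε n) * (h (m + 1) - h m) := by
        rw [Finset.sum_range_succ, Finset.sum_range_succ]; ring
      rw [e]
      refine (abs_sub _ _).trans ?_
      rw [abs_mul]
      have := mul_le_mul (hε (m + 1)) (hV m) (abs_nonneg _) hη
      linarith
  have h2 : |(∑ n ∈ Finset.range m, ε n) * h m| ≤ η * C := by
    rw [abs_mul]
    exact mul_le_mul (hε m) (hh m) (abs_nonneg _) hη
  calc _ = |(∑ n ∈ Finset.range m, ε n * h n - (∑ n ∈ Finset.range m, ε n) * h m)
        + (∑ n ∈ Finset.range m, ε n) * h m| := by congr 1; ring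
    _ ≤ _ := abs_add_le _ _
    _ ≤ _ := by linarith

/-- The logarithm of `∏ 2Φ(r αₙ)`. -/
noncomputable def logProdTwoPhi (α : ℕ → ℝ) (r : ℝ) : ℝ := ∑' n, logTwoPhi (r * α n)

theorem summable_logTwoPhi {α : ℕ → ℝ} (hα : ∀ n, 0 ≤ α n) (hs : Summable α) {r : ℝ}
    (hr : 0 ≤ r) : Summable fun n => logTwoPhi (r * α n) :=
  Summable.of_nonneg_of_le (fun n => logTwoPhi_nonneg (mul_nonneg hr (hα n)))
    (fun n => logTwoPhi_le (mul_nonneg hr (hα n))) (hs.mul_left r)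

theorem tendsto_logProdTwoPhi_sub {α β : ℕ → ℝ} (hα : ∀ n, 0 < α n) (hβ : ∀ n, 0 < β n)
    (hαs : Summable α) (hβs : Summable β) (hβa : Antitone β)
    (hsum : ∃ l, Tendsto (fun m => ∑ n ∈ Finset.range m, (α n / β n - 1)) atTop (𝓝 l))
    (hsq : Summable fun n => (α n / β n - 1) ^ 2) :
    Tendsto (fun r => logProdTwoPhi α r - logProdTwoPhi β r) atTop (𝓝 0) := by
  set ε : ℕ → ℝ := fun n => α n / β n - 1 with hεdef
  have hαβ : ∀ n, α n = β n * (1 + ε n) := fun n => by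
    have := (hβ n).ne'
    simp only [hεdef]; field_simp; ring
  rw [Metric.tendsto_nhds]
  intro δ hδ
  obtain ⟨l, hl⟩ := hsum
  have hcau := Metric.cauchySeq_iff'.1 hl.cauchySeq (δ / 400) (by positivity)
  obtain ⟨N₁, hN₁⟩ := hcau
  have htail := (tendsto_sum_nat_add fun n => ε n ^ 2).eventually
    (gt_mem_nhds (show (0 : ℝ) < δ / 400 by positivity))
  have hsmall : ∀ᶠ n in atTop, ε n ^ 2 < 1 / 4 :=
    hsq.tendsto_atTop_zero.eventually (gt_mem_nhds (by norm_num))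
  obtain ⟨N₂, hN₂⟩ := eventually_atTop.1 (htail.and hsmall)
  set N := max N₁ N₂ with hN
  have hε : ∀ m, |∑ n ∈ Finset.range m, ε (n + N)| ≤ δ / 200 := fun m => by
    have e : ∑ n ∈ Finset.range m, ε (n + N)
        = ∑ n ∈ Finset.range (N + m), ε n - ∑ n ∈ Finset.range N, ε n := by
      rw [Finset.sum_range_add, add_sub_cancel_left]
      exact Finset.sum_congr rfl fun n _ => by rw [add_comm]
    have h1 := hN₁ (N + m) (by omega)
    have h2 := hN₁ N (by omega)
    rw [Real.dist_eq] at h1 h2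
    rw [e]
    rw [abs_lt] at h1 h2
    rw [abs_le]
    constructor <;> linarith [h1.1, h1.2, h2.1, h2.2]
  have hεabs : ∀ n, |ε (n + N)| ≤ 1 / 2 := fun n => by
    have := (hN₂ (n + N) (by omega)).2
    exact abs_le_of_sq_le_sq (by linarith) (by norm_num)
  have hsqN : ∑' n, ε (n + N) ^ 2 < δ / 400 := (hN₂ N (by omega)).1
  have hfin : Tendsto (fun r => ∑ n ∈ Finset.range N,
      (logTwoPhi (r * α n) - logTwoPhi (r * β n))) atTop (𝓝 0) := by
    rw [show (0 : ℝ) = ∑ n ∈ Finset.range N, (log 2 - log 2) by simp]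
    exact tendsto_finsetSum _ fun n _ =>
      (tendsto_logTwoPhi_atTop.comp (tendsto_id.atTop_mul_const (hα n))).sub
        (tendsto_logTwoPhi_atTop.comp (tendsto_id.atTop_mul_const (hβ n)))
  filter_upwards [Metric.tendsto_nhds.1 hfin (δ / 4) (by positivity), eventually_gt_atTop 0]
    with r hr hr0
  have hSα := summable_logTwoPhi (fun n => (hα n).le) hαs hr0.le
  have hSβ := summable_logTwoPhi (fun n => (hβ n).le) hβs hr0.le
  have hS := hSα.sub hSβ
  -- Budget: Abel summation costs δ/200 · (32 + 32), the quadratic errors cost 64 · δ/400, in total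
  -- 0.48 δ. The first N terms take δ/4 more.
  have hpart : ∀ m, |∑ n ∈ Finset.range m,
      (logTwoPhi (r * α (n + N)) - logTwoPhi (r * β (n + N)))| ≤ 3 / 4 * δ - δ / 100 := fun m => by
    have e : ∑ n ∈ Finset.range m, (logTwoPhi (r * α (n + N)) - logTwoPhi (r * β (n + N)))
        = ∑ n ∈ Finset.range m, ε (n + N) * (r * β (n + N) * invMills (r * β (n + N)))
          + ∑ n ∈ Finset.range m, (logTwoPhi (r * β (n + N) * (1 + ε (n + N)))
            - logTwoPhi (r * β (n + N))
            - ε (n + N) * (r * β (n + N) * invMills (r * β (n + N)))) := by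
      rw [← Finset.sum_add_distrib]
      refine Finset.sum_congr rfl fun n _ => ?_
      rw [hαβ (n + N), ← mul_assoc r]; ring
    have h1 := abs_sum_mul_le_of_variation (ε := fun n => ε (n + N))
      (h := fun n => r * β (n + N) * invMills (r * β (n + N)))
      (V := fun n => 16 * arctan (r * β (n + N))) (η := δ / 200) (C := 32) (by positivity) hε
      (fun n => mul_invMills_le (mul_pos hr0 (hβ _)).le)
      (fun n => by
        rw [abs_sub_comm]
        exact abs_mul_invMills_sub_le (mul_pos hr0 (hβ _)).le
          (mul_le_mul_of_nonneg_left (hβa (by omega)) hr0.le)) m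
    have h2 : |∑ n ∈ Finset.range m, (logTwoPhi (r * β (n + N) * (1 + ε (n + N)))
            - logTwoPhi (r * β (n + N))
            - ε (n + N) * (r * β (n + N) * invMills (r * β (n + N))))| ≤ 64 * (δ / 400) := by
      refine (Finset.abs_sum_le_sum_abs _ _).trans ?_
      calc _ ≤ ∑ n ∈ Finset.range m, 64 * ε (n + N) ^ 2 :=
            Finset.sum_le_sum fun n _ => abs_logTwoPhi_taylor (mul_pos hr0 (hβ _)) (hεabs n)
        _ = 64 * ∑ n ∈ Finset.range m, ε (n + N) ^ 2 := by rw [Finset.mul_sum]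
        _ ≤ 64 * ∑' n, ε (n + N) ^ 2 := by
            gcongr
            exact ((summable_nat_add_iff N).2 hsq).sum_le_tsum _ fun n _ => sq_nonneg _
        _ ≤ _ := by gcongr
    have h3 : 16 * arctan (r * β (0 + N)) - 16 * arctan (r * β (m + N)) ≤ 32 := by
      have := arctan_lt_pi_div_two (r * β (0 + N))
      have := arctan_nonneg.2 (mul_pos hr0 (hβ (m + N))).le
      linarith [pi_lt_four]
    have h4 := mul_le_mul_of_nonneg_left h3 (show 0 ≤ δ / 200 by positivity)
    rw [e]
    refine (abs_add_le _ _).trans ?_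
    linarith
  have hlim := ((summable_nat_add_iff N).2 hS).hasSum.tendsto_sum_nat.abs
  have htl := le_of_tendsto' hlim hpart
  rw [Real.dist_eq, sub_zero] at hr ⊢
  unfold logProdTwoPhi
  rw [← hSα.tsum_sub hSβ, ← hS.sum_add_tsum_nat_add N]
  refine (abs_add_le _ _).trans_lt ?_
  linarith

/-! ### What convergence of the two infinite products gives. -/

theorem InfiniteProductConverges.tendsto_one {u : ℕ → ℝ} (h : InfiniteProductConverges u) :
    Tendsto u atTop (𝓝 1) := by
  obtain ⟨N, p, hp, hl⟩ := h
  have h1 := (hl.comp (tendsto_add_atTop_nat 1)).div hl hp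
  rw [div_self hp] at h1
  have hne : ∀ᶠ m in atTop, ∏ k ∈ Finset.range m, u (N + k) ≠ 0 := hl.eventually_ne hp
  rw [← tendsto_add_atTop_iff_nat N]
  refine h1.congr' ?_
  filter_upwards [hne] with m hm
  simp only [Pi.div_apply, Function.comp]
  rw [Finset.prod_range_succ, mul_div_cancel_left₀ _ hm, add_comm]

/-- No factor vanishes from index N on, and `Real.log` is log|·| with value 0 at 0, so negative
factors and early zeros do no harm. -/
theorem InfiniteProductConverges.tendsto_sum_log {u : ℕ → ℝ} (h : InfiniteProductConverges u) :
    ∃ l, Tendsto (fun m => ∑ n ∈ Finset.range m, log (u n)) atTop (𝓝 l) := by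
  have h1 := h.tendsto_one
  obtain ⟨N, p, hp, hl⟩ := h
  have hnz : ∀ k, u (N + k) ≠ 0 := fun k hk => by
    refine hp (tendsto_nhds_unique hl (tendsto_const_nhds.congr' ?_))
    filter_upwards [eventually_gt_atTop k] with m hm
    exact (Finset.prod_eq_zero (Finset.mem_range.2 hm) hk).symm
  refine ⟨∑ n ∈ Finset.range N, log (u n) + log p, ?_⟩
  rw [← tendsto_add_atTop_iff_nat N]
  refine ((hl.log hp).const_add _).congr fun m => ?_
  rw [add_comm m N, Finset.sum_range_add, Real.log_prod fun k _ => hnz k]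

/-- Convergence of both `∏ (2 - cₙ)` and `∏ (2 - 1/cₙ)` means that `cₙ - 1` is summable in order
and square summable. -/
theorem summable_of_infiniteProductConverges {c : ℕ → ℝ} (hc : ∀ n, 0 < c n)
    (h1 : InfiniteProductConverges fun n => 2 - c n)
    (h2 : InfiniteProductConverges fun n => 2 - (c n)⁻¹) :
    (∃ l, Tendsto (fun m => ∑ n ∈ Finset.range m, (c n - 1)) atTop (𝓝 l)) ∧
      Summable fun n => (c n - 1) ^ 2 := by
  have hc1 : Tendsto c atTop (𝓝 1) := by
    have := h1.tendsto_one.const_sub 2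
    norm_num at this
    exact this
  have hnear : ∀ᶠ n in atTop, |c n - 1| ≤ 1 / 4 := by
    filter_upwards [Metric.tendsto_nhds.1 hc1 (1 / 4) (by norm_num)] with n hn
    exact hn.le
  obtain ⟨N, hN⟩ := eventually_atTop.1 hnear
  obtain ⟨l₁, hl₁⟩ := h1.tendsto_sum_log
  obtain ⟨l₂, hl₂⟩ := h2.tendsto_sum_log
  have hlog : ∀ n, N ≤ n → (c n - 1) ^ 2 ≤ -(log (2 - c n) + log (2 - (c n)⁻¹)) := fun n hn => by
    obtain ⟨ha, hb⟩ := abs_le.1 (hN n hn)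
    have hcn := hc n
    have he : (c n)⁻¹ < 2 := by rw [inv_lt_comm₀ hcn (by norm_num)]; linarith
    rw [← log_mul (by linarith) (by linarith)]
    have := log_le_sub_one_of_pos
      (mul_pos (show 0 < 2 - c n by linarith) (show 0 < 2 - (c n)⁻¹ by linarith))
    -- The first-order terms cancel in the product of the two factors; hence the sum of their
    -- logarithms controls (cₙ - 1)².
    have e : (2 - c n) * (2 - (c n)⁻¹) - 1 = -(2 * (c n - 1) ^ 2 / c n) := by field_simp; ring
    rw [e] at this
    have : (c n - 1) ^ 2 ≤ 2 * (c n - 1) ^ 2 / c n := by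
      rw [le_div_iff₀ hcn]; nlinarith [sq_nonneg (c n - 1)]
    linarith
  have hsq : Summable fun n => (c n - 1) ^ 2 := by
    rw [← summable_nat_add_iff N]
    refine Summable.of_nonneg_of_le (fun n => sq_nonneg _) (fun n => hlog (n + N) (by omega)) ?_
    refine ((hasSum_iff_tendsto_nat_of_nonneg
      (fun n => (sq_nonneg _).trans (hlog (n + N) (by omega)))
      (-(l₁ + l₂) - ∑ n ∈ Finset.range N, -(log (2 - c n) + log (2 - (c n)⁻¹)))).2 ?_).summable
    have := ((((hl₁.add hl₂).neg).sub_const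
      (∑ n ∈ Finset.range N, -(log (2 - c n) + log (2 - (c n)⁻¹)))).comp
        (tendsto_add_atTop_nat N))
    refine this.congr fun m => ?_
    simp only [Function.comp]
    rw [← Finset.sum_add_distrib, ← Finset.sum_neg_distrib, add_comm m N, Finset.sum_range_add,
      add_sub_cancel_left]
    exact Finset.sum_congr rfl fun n _ => by rw [add_comm N n]
  refine ⟨?_, hsq⟩
  -- With t = cₙ - 1, log(1 - t) = -t + O(t²); square summability then transfers ordered convergence
  -- from the logarithms to ∑ t.
  have herr : Summable fun n => (c n - 1) + log (2 - c n) := by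
    refine Summable.of_norm_bounded_eventually_nat (hsq.mul_left 2) ?_
    filter_upwards [hnear] with n hn
    have h := abs_log_sub_add_sum_range_le (x := c n - 1) (by linarith) 1
    simp only [Finset.sum_range_one, zero_add, pow_one, Nat.cast_zero, div_one,
      show 1 - (c n - 1) = 2 - c n by ring] at h
    rw [Real.norm_eq_abs]
    refine h.trans ?_
    rw [div_le_iff₀ (by linarith), ← sq_abs (c n - 1)]
    have := mul_le_mul_of_nonneg_left (show (1 : ℝ) / 2 ≤ 1 - |c n - 1| by linarith)
      (sq_nonneg |c n - 1|)
    norm_num at this ⊢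
    linarith
  refine ⟨_, (herr.hasSum.tendsto_sum_nat.sub hl₁).congr fun m => ?_⟩
  rw [← Finset.sum_sub_distrib]
  exact Finset.sum_congr rfl fun n _ => by ring

/-! ### Gaussian tails under an exponential tilt. -/

theorem integral_exp_neg_mul_Ioi {r : ℝ} (hr : 0 < r) :
    ∫ x in Set.Ioi (0 : ℝ), exp (-(r * x)) = 1 / r := by
  have := integral_rpow_mul_exp_neg_mul_Ioi (a := 1) (r := r) one_pos hr
  simpa using this

theorem integral_sq_mul_exp_neg_mul_Ioi {r : ℝ} (hr : 0 < r) :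
    ∫ x in Set.Ioi (0 : ℝ), x ^ 2 * exp (-(r * x)) = 2 / r ^ 3 := by
  have := integral_rpow_mul_exp_neg_mul_Ioi (a := 3) (r := r) (by norm_num) hr
  rw [show (3 : ℝ) = ((2 : ℕ) : ℝ) + 1 by norm_num, Real.Gamma_nat_eq_factorial] at this
  norm_num at this
  rw [this]
  field_simp

theorem integrableOn_exp_neg_mul_Ioi {r : ℝ} (hr : 0 < r) :
    IntegrableOn (fun x => exp (-(r * x))) (Set.Ioi 0) := by
  -- A non-integrable function has integral 0 by convention, against the positive value just
  -- computed.
  by_contra h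
  have := integral_undef h
  rw [integral_exp_neg_mul_Ioi hr] at this
  exact absurd this (by positivity)

theorem integrableOn_sq_mul_exp_neg_mul_Ioi {r : ℝ} (hr : 0 < r) :
    IntegrableOn (fun x => x ^ 2 * exp (-(r * x))) (Set.Ioi 0) := by
  by_contra h
  have := integral_undef h
  rw [integral_sq_mul_exp_neg_mul_Ioi hr] at this
  exact absurd this (by positivity)

/-- The upper tail of a centred Gaussian law, with an exponential tilt by `r` made explicit. -/
theorem gaussianReal_Ici_eq {v : ℝ≥0} (hv : v ≠ 0) (u r : ℝ) :
    IntegrableOn (fun x => exp (-(r * x)) * exp (-(x + (u - r * v)) ^ 2 / (2 * v))) (Set.Ioi 0) ∧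
    (gaussianReal 0 v).real (Set.Ici u) = (√(2 * π * v))⁻¹ * exp (r ^ 2 * v / 2 - r * u) *
      ∫ x in Set.Ioi (0 : ℝ), exp (-(r * x)) * exp (-(x + (u - r * v)) ^ 2 / (2 * v)) := by
  have hv' : (0 : ℝ) < v := NNReal.coe_pos.2 (pos_iff_ne_zero.2 hv)
  have hc : (√(2 * π * v))⁻¹ * exp (r ^ 2 * v / 2 - r * u) ≠ 0 := by positivity
  have e : ∀ x : ℝ, gaussianPDFReal 0 v (x + u) =
      (√(2 * π * v))⁻¹ * exp (r ^ 2 * v / 2 - r * u) *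
        (exp (-(r * x)) * exp (-(x + (u - r * v)) ^ 2 / (2 * v))) := fun x => by
    rw [gaussianPDFReal, mul_assoc (√(2 * π * v))⁻¹, ← exp_add, ← exp_add]
    congr 2
    field_simp
    ring
  have hint : Integrable fun x => gaussianPDFReal 0 v (x + u) :=
    (integrable_gaussianPDFReal 0 v).comp_add_right u
  constructor
  · have := (hint.const_mul ((√(2 * π * v))⁻¹ * exp (r ^ 2 * v / 2 - r * u))⁻¹).integrableOn
      (s := Set.Ioi 0)
    refine this.congr_fun (fun x _ => ?_) measurableSet_Ioi
    simp only
    rw [e, inv_mul_cancel_left₀ hc]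
  · rw [← integral_const_mul, measureReal_def, gaussianReal_apply_eq_integral 0 hv,
      ENNReal.toReal_ofReal (integral_nonneg fun x => gaussianPDFReal_nonneg _ _ _),
      integral_Ici_eq_integral_Ioi]
    have := (measurePreserving_add_right volume u).setIntegral_preimage_emb
      (measurableEmbedding_addRight u) (gaussianPDFReal 0 v) (Set.Ioi u)
    rw [show (fun x => x + u) ⁻¹' Set.Ioi u = Set.Ioi (0 : ℝ) by ext x; simp] at this
    rw [← this]
    exact integral_congr_ae (ae_of_all _ e)

theorem gaussianReal_Ici_le {v : ℝ≥0} (hv : v ≠ 0) (u : ℝ) {r : ℝ} (hr : 0 < r) :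
    (gaussianReal 0 v).real (Set.Ici u) ≤
      (√(2 * π * v))⁻¹ * exp (r ^ 2 * v / 2 - r * u) / r := by
  obtain ⟨hi, he⟩ := gaussianReal_Ici_eq hv u r
  rw [he, div_eq_mul_one_div _ r, ← integral_exp_neg_mul_Ioi hr]
  refine mul_le_mul_of_nonneg_left ?_ (by positivity)
  refine integral_mono hi (integrableOn_exp_neg_mul_Ioi hr) fun x => ?_
  refine mul_le_of_le_one_right (exp_pos _).le (exp_le_one_iff.2 ?_)
  rw [neg_div]
  exact neg_nonpos.2 (by positivity)

/-- From e^y ≥ 1 + y and (x + w)² ≤ 2x² + 2w² with w = u - rv, the tilted integral is bounded below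
by exact moments of e^{-rx}. -/
theorem le_gaussianReal_Ici {v : ℝ≥0} (hv : v ≠ 0) (u : ℝ) {r : ℝ} (hr : 0 < r) :
    (√(2 * π * v))⁻¹ * exp (r ^ 2 * v / 2 - r * u) / r *
      (1 - (2 / r ^ 2 + (u - r * v) ^ 2) / v) ≤ (gaussianReal 0 v).real (Set.Ici u) := by
  have hv' : (0 : ℝ) < v := NNReal.coe_pos.2 (pos_iff_ne_zero.2 hv)
  obtain ⟨hi, he⟩ := gaussianReal_Ici_eq hv u r
  rw [he, div_mul_eq_mul_div, mul_div_assoc]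
  refine mul_le_mul_of_nonneg_left ?_ (by positivity)
  set w := u - r * v
  have i1 := (integrableOn_exp_neg_mul_Ioi hr).const_mul (1 - w ^ 2 / v)
  have i2 := (integrableOn_sq_mul_exp_neg_mul_Ioi hr).const_mul (1 / (v : ℝ))
  calc (1 - (2 / r ^ 2 + w ^ 2) / v) / r
      = (1 - w ^ 2 / v) * (1 / r) - 1 / v * (2 / r ^ 3) := by field_simp; ring
    _ = ∫ x in Set.Ioi (0 : ℝ), ((1 - w ^ 2 / v) * exp (-(r * x))
          - 1 / v * (x ^ 2 * exp (-(r * x)))) := by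
        rw [integral_sub i1 i2, integral_const_mul, integral_const_mul,
          integral_exp_neg_mul_Ioi hr, integral_sq_mul_exp_neg_mul_Ioi hr]
    _ ≤ _ := by
        refine integral_mono (i1.sub i2) hi fun x => ?_
        simp only
        have h1 := add_one_le_exp (-(x + w) ^ 2 / (2 * v))
        have h2 : 1 - w ^ 2 / v - x ^ 2 / v ≤ -(x + w) ^ 2 / (2 * v) + 1 := by
          have : 0 ≤ (x - w) ^ 2 / (2 * v) := by positivity
          have e : -(x + w) ^ 2 / (2 * v) + 1
            = 1 - w ^ 2 / v - x ^ 2 / v + (x - w) ^ 2 / (2 * v) := by field_simp; ring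
          linarith
        calc _ = exp (-(r * x)) * (1 - w ^ 2 / v - x ^ 2 / v) := by ring
          _ ≤ _ := mul_le_mul_of_nonneg_left (h2.trans h1) (exp_pos _).le

/-- The right side is 4 sinh²(w/2). This trades a squared deviation for exponentials, so that later
errors involve only moment generating functions at r ± 1. -/
theorem sq_le_exp_add_exp_neg (w : ℝ) : w ^ 2 ≤ exp w + exp (-w) - 2 := by
  have h : |w / 2| ≤ |sinh (w / 2)| := by
    rw [abs_sinh]
    exact self_le_sinh_iff.2 (abs_nonneg _)
  have h2 := sq_le_sq.2 h
  have h3 := cosh_two_mul (w / 2)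
  rw [cosh_sq, show 2 * (w / 2) = w by ring, cosh_eq] at h3
  linarith

/-! ### A Gaussian plus an independent variable, and reflection. -/

section Independence

variable {Ω : Type*} [MeasurableSpace Ω] {P : Measure Ω} [IsProbabilityMeasure P]

/-- Fubini for the tail of a sum of two independent variables. -/
theorem measureReal_add_ge_eq_integral {G R : Ω → ℝ} {μ : Measure ℝ} [IsProbabilityMeasure μ]
    (hG : HasLaw G μ P) (hR : Measurable R) (hind : IndepFun G R P) (r : ℝ) :
    Integrable (fun ω => μ.real (Set.Ici (r - R ω))) P ∧
    P.real {ω | r ≤ G ω + R ω} = ∫ ω, μ.real (Set.Ici (r - R ω)) ∂P := by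
  have hmeas : Measurable fun ρ : ℝ => μ.real (Set.Ici (r - ρ)) := by
    refine Monotone.measurable fun x y hxy => ?_
    exact measureReal_mono (Set.Ici_subset_Ici.2 (by linarith))
  refine ⟨Integrable.of_bound (hmeas.comp hR).aestronglyMeasurable 1 (ae_of_all _ fun ω => ?_), ?_⟩
  · rw [Real.norm_of_nonneg measureReal_nonneg]
    exact measureReal_le_one
  have hR' : HasLaw R (P.map R) P := ⟨hR.aemeasurable, rfl⟩
  have : IsProbabilityMeasure (P.map R) := Measure.isProbabilityMeasure_map hR.aemeasurable
  have h := hind.hasLaw_prod hG hR'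
  have hset : MeasurableSet {p : ℝ × ℝ | r ≤ p.1 + p.2} :=
    measurableSet_le measurable_const (measurable_fst.add measurable_snd)
  rw [h.measureReal_eq (p := fun p : ℝ × ℝ => r ≤ p.1 + p.2) hset, measureReal_def,
    Measure.prod_apply_symm hset, ← integral_map (f := fun ρ => μ.real (Set.Ici (r - ρ)))
      hR.aemeasurable hmeas.aestronglyMeasurable, integral_eq_lintegral_of_nonneg_ae
      (ae_of_all _ fun _ => measureReal_nonneg) hmeas.aestronglyMeasurable]
  congr 1
  refine lintegral_congr fun ρ => ?_
  rw [ofReal_measureReal]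
  congr 1
  ext x
  simp only [Set.mem_preimage, Set.mem_ofPred_eq, Set.mem_Ici]
  constructor <;> intro h <;> linarith

/-- Apply the tilted bound at u = r - R; the exponent is affine in R, so integration yields the
moment generating function at r. -/
theorem measureReal_gaussian_add_ge_le {G R : Ω → ℝ} {v : ℝ≥0} (hv : v ≠ 0)
    (hG : HasLaw G (gaussianReal 0 v) P) (hR : Measurable R) (hind : IndepFun G R P)
    {r : ℝ} (hr : 0 < r) (hint : Integrable (fun ω => exp (r * R ω)) P) :
    P.real {ω | r ≤ G ω + R ω} ≤
      (√(2 * π * v))⁻¹ * exp (r ^ 2 * v / 2 - r ^ 2) / r * mgf R P r := by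
  obtain ⟨hi, he⟩ := measureReal_add_ge_eq_integral hG hR hind r
  rw [he, mgf, ← integral_const_mul]
  refine integral_mono hi (hint.const_mul _) fun ω => ?_
  refine (gaussianReal_Ici_le hv (r - R ω) hr).trans_eq ?_
  rw [show r ^ 2 * v / 2 - r * (r - R ω) = r ^ 2 * v / 2 - r ^ 2 + r * R ω by ring, exp_add]
  ring

theorem le_measureReal_gaussian_add_ge {G R : Ω → ℝ} {v : ℝ≥0} (hv : v ≠ 0)
    (hG : HasLaw G (gaussianReal 0 v) P) (hR : Measurable R) (hind : IndepFun G R P)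
    {r τ : ℝ} (hr : 0 < r) (hτ : v + τ = 1) (hint : Integrable (fun ω => exp (r * R ω)) P)
    (hint1 : Integrable (fun ω => exp ((r + 1) * R ω)) P)
    (hint2 : Integrable (fun ω => exp ((r - 1) * R ω)) P) :
    (√(2 * π * v))⁻¹ * exp (r ^ 2 * v / 2 - r ^ 2) / r *
      (mgf R P r - (2 / r ^ 2 * mgf R P r + (exp (r * τ) * mgf R P (r - 1)
        + exp (-(r * τ)) * mgf R P (r + 1) - 2 * mgf R P r)) / v)
      ≤ P.real {ω | r ≤ G ω + R ω} := by
  have hv' : (0 : ℝ) < v := NNReal.coe_pos.2 (pos_iff_ne_zero.2 hv)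
  obtain ⟨hi, he⟩ := measureReal_add_ge_eq_integral hG hR hind r
  set c := (√(2 * π * v))⁻¹ * exp (r ^ 2 * v / 2 - r ^ 2) / r with hc
  have hc0 : 0 ≤ c := by positivity
  have j1 : Integrable (fun ω => exp (r * τ) * exp ((r - 1) * R ω)
      + exp (-(r * τ)) * exp ((r + 1) * R ω)) P :=
    (hint2.const_mul (exp (r * τ))).add (hint1.const_mul (exp (-(r * τ))))
  have j2 : Integrable (fun ω => exp (r * τ) * exp ((r - 1) * R ω)
      + exp (-(r * τ)) * exp ((r + 1) * R ω) - 2 * exp (r * R ω)) P :=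
    j1.sub (hint.const_mul 2)
  have j3 : Integrable (fun ω => 2 / r ^ 2 * exp (r * R ω) + (exp (r * τ) * exp ((r - 1) * R ω)
      + exp (-(r * τ)) * exp ((r + 1) * R ω) - 2 * exp (r * R ω))) P :=
    (hint.const_mul (2 / r ^ 2)).add j2
  have j4 := hint.sub (j3.div_const (v : ℝ))
  have key : ∫ ω, c * (exp (r * R ω) - (2 / r ^ 2 * exp (r * R ω) +
      (exp (r * τ) * exp ((r - 1) * R ω) + exp (-(r * τ)) * exp ((r + 1) * R ω)
        - 2 * exp (r * R ω))) / v) ∂P ≤ P.real {ω | r ≤ G ω + R ω} := by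
    rw [he]
    refine integral_mono (j4.const_mul c) hi fun ω => ?_
    refine le_trans ?_ (le_gaussianReal_Ici hv (r - R ω) hr)
    have e1 : (√(2 * π * v))⁻¹ * exp (r ^ 2 * v / 2 - r * (r - R ω)) / r = c * exp (r * R ω) := by
      rw [show r ^ 2 * v / 2 - r * (r - R ω) = r ^ 2 * v / 2 - r ^ 2 + r * R ω by ring, exp_add,
        hc]
      ring
    rw [e1, mul_assoc]
    refine mul_le_mul_of_nonneg_left ?_ hc0
    -- As v + τ = 1, w = rτ - R measures the deviation of R from rτ; multiplying e^{rR} by e^{±w}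
    -- shifts the tilt to r ∓ 1.
    set w := r - R ω - r * v with hw
    have hw' : w = r * τ - R ω := by rw [hw, show (v : ℝ) = 1 - τ by linarith]; ring
    have hsq := sq_le_exp_add_exp_neg w
    have e2 : exp (r * τ) * exp ((r - 1) * R ω) = exp (r * R ω) * exp w := by
      rw [← exp_add, ← exp_add, hw']; congr 1; ring
    have e3 : exp (-(r * τ)) * exp ((r + 1) * R ω) = exp (r * R ω) * exp (-w) := by
      rw [← exp_add, ← exp_add, hw']; congr 1; ring
    simp only
    rw [e2, e3]
    calc _ = exp (r * R ω) * (1 - (2 / r ^ 2 + (exp w + exp (-w) - 2)) / v) := by ring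
      _ ≤ _ := by gcongr
  refine le_trans (le_of_eq ?_) key
  rw [integral_const_mul]
  congr 1
  rw [integral_sub hint (j3.div_const (v : ℝ)), integral_div]
  simp only [mgf]
  congr 2
  rw [integral_add (hint.const_mul (2 / r ^ 2)) j2, integral_sub j1 (hint.const_mul 2),
    integral_add (hint2.const_mul (exp (r * τ))) (hint1.const_mul (exp (-(r * τ))))]
  simp only [integral_const_mul]

/-- Reflection: replacing `|Z|` by `Z` for a symmetric variable halves the tail, up to the
tail of the remaining summand. -/
theorem abs_measureReal_abs_add_sub_le {Z W : Ω → ℝ} {μ : Measure ℝ} [IsProbabilityMeasure μ]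
    (hZ : HasLaw Z μ P) (hZ' : HasLaw (-Z) μ P) (hmZ : Measurable Z) (hW : Measurable W)
    (hind : IndepFun Z W P) {c : ℝ} (hc : 0 ≤ c) (r : ℝ) :
    |P.real {ω | r ≤ c * |Z ω| + W ω} - 2 * P.real {ω | r ≤ c * Z ω + W ω}|
      ≤ P.real {ω | r ≤ W ω} := by
  set A := {ω | r ≤ c * Z ω + W ω} with hA
  set B := {ω | r ≤ c * (-Z) ω + W ω} with hB
  have hAm : MeasurableSet A := measurableSet_le measurable_const (by fun_prop)
  have hBm : MeasurableSet B := measurableSet_le measurable_const (by fun_prop)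
  have hset : MeasurableSet {p : ℝ × ℝ | r ≤ c * p.1 + p.2} :=
    measurableSet_le measurable_const (by fun_prop)
  have hW' : HasLaw W (P.map W) P := ⟨hW.aemeasurable, rfl⟩
  have hAB : P.real B = P.real A := by
    have h1 := (hind.hasLaw_prod hZ hW').measureReal_eq hset
    have hind' : IndepFun (-Z) W P := hind.comp measurable_neg measurable_id
    have h2 := (hind'.hasLaw_prod hZ' hW').measureReal_eq hset
    rw [hA, hB]
    exact h2.trans h1.symm
  have hU : {ω | r ≤ c * |Z ω| + W ω} = A ∪ B := by
    ext ω
    simp only [hA, hB, Set.mem_ofPred_eq, Set.mem_union, Pi.neg_apply]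
    constructor
    · intro h
      rcases abs_choice (Z ω) with h' | h' <;> rw [h'] at h
      exacts [Or.inl h, Or.inr h]
    · rintro (h | h)
      · linarith [mul_le_mul_of_nonneg_left (le_abs_self (Z ω)) hc]
      · linarith [mul_le_mul_of_nonneg_left (neg_le_abs (Z ω)) hc]
  -- Averaging the inequalities defining A and B cancels Z.
  have hI : P.real (A ∩ B) ≤ P.real {ω | r ≤ W ω} := by
    refine measureReal_mono fun ω hω => ?_
    simp only [hA, hB, Set.mem_inter_iff, Set.mem_ofPred_eq, Pi.neg_apply] at hω ⊢
    linarith [hω.1, hω.2]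
  have h := measureReal_union_add_inter (μ := P) (s := A) hBm
  rw [hU, abs_le]
  constructor <;> linarith [measureReal_nonneg (μ := P) (s := A ∩ B),
    measureReal_nonneg (μ := P) (s := {ω | r ≤ W ω})]

end Independence

/-! ### The random series: measurability, independence, exponential moments. -/

theorem logProdTwoPhi_mono {α : ℕ → ℝ} (hα : ∀ n, 0 ≤ α n) (hs : Summable α) {r s : ℝ}
    (hr : 0 ≤ r) (hrs : r ≤ s) : logProdTwoPhi α r ≤ logProdTwoPhi α s :=
  (summable_logTwoPhi hα hs hr).tsum_le_tsum
    (fun n => logTwoPhi_mono (mul_nonneg hr (hα n)) (mul_le_mul_of_nonneg_right hrs (hα n)))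
    (summable_logTwoPhi hα hs (hr.trans hrs))

theorem logProdTwoPhi_add_one_sub_le {α : ℕ → ℝ} (hα : ∀ n, 0 ≤ α n) (hs : Summable α) {r : ℝ}
    (hr : 0 ≤ r) : logProdTwoPhi α (r + 1) - logProdTwoPhi α r ≤ ∑' n, α n := by
  have h1 := summable_logTwoPhi hα hs hr
  have h2 := summable_logTwoPhi hα hs (r := r + 1) (by linarith)
  unfold logProdTwoPhi
  rw [← h2.tsum_sub h1]
  refine (h2.sub h1).tsum_le_tsum (fun n => ?_) hs
  refine (logTwoPhi_sub_le (mul_nonneg hr (hα n)) ?_).trans_eq (by ring)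
  nlinarith [hα n]

/-- The random series `∑ αₙ |Zₙ|`. -/
noncomputable def absSum {Ω : Type*} (Z : ℕ → Ω → ℝ) (α : ℕ → ℝ) (ω : Ω) : ℝ :=
  ∑' n, α n * |Z n ω|

/-- The linear form `∑ αₙ Zₙ` over the first `k` indices. -/
noncomputable def linSum {Ω : Type*} (Z : ℕ → Ω → ℝ) (α : ℕ → ℝ) (k : ℕ) (ω : Ω) : ℝ :=
  ∑ n ∈ Finset.range k, α n * Z n ω

theorem measurable_linSum {Ω : Type*} {m : MeasurableSpace Ω} {Z : ℕ → Ω → ℝ} (α : ℕ → ℝ) {k : ℕ}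
    (hZ : ∀ n < k, Measurable (Z n)) : Measurable (linSum Z α k) := by
  unfold linSum
  exact Finset.measurable_fun_sum _ fun n hn => (hZ n (Finset.mem_range.1 hn)).const_mul _

/-- Valid even where the series diverges: both sides are then 0. -/
theorem absSum_eq_toReal {Ω : Type*} {Z : ℕ → Ω → ℝ} {α : ℕ → ℝ} (hα : ∀ n, 0 ≤ α n) (ω : Ω) :
    absSum Z α ω = (∑' n, ENNReal.ofReal (α n * |Z n ω|)).toReal := by
  rw [ENNReal.tsum_toReal_eq fun n => ENNReal.ofReal_ne_top]
  exact tsum_congr fun n => (ENNReal.toReal_ofReal (mul_nonneg (hα n) (abs_nonneg _))).symm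

/-- The σ-algebra is arbitrary so that it can be the one generated by a block of the Zₙ, as the
independence arguments require. -/
theorem measurable_absSum {Ω : Type*} {m : MeasurableSpace Ω} {Z : ℕ → Ω → ℝ} {α : ℕ → ℝ}
    (hα : ∀ n, 0 ≤ α n) (hZ : ∀ n, Measurable (Z n)) : Measurable (absSum Z α) := by
  have : absSum Z α = fun ω => (∑' n, ENNReal.ofReal (α n * |Z n ω|)).toReal :=
    funext fun ω => absSum_eq_toReal hα ω
  rw [this]
  exact (Measurable.tsum fun n =>
    ENNReal.measurable_ofReal.comp ((measurable_abs.comp (hZ n)).const_mul _)).ennreal_toReal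

section Sequence

variable {Ω : Type*} [MeasurableSpace Ω] {P : Measure Ω}
  {Z : ℕ → Ω → ℝ} {α : ℕ → ℝ}

theorem iIndepFun.indepFun_of_disjoint (hindep : iIndepFun Z P) (hm : ∀ n, Measurable (Z n))
    {S T : Set ℕ} (hST : Disjoint S T) {f g : Ω → ℝ}
    (hf : Measurable[⨆ i ∈ S, MeasurableSpace.comap (Z i) inferInstance] f)
    (hg : Measurable[⨆ i ∈ T, MeasurableSpace.comap (Z i) inferInstance] g) :
    IndepFun f g P := by
  have h := indep_iSup_of_disjoint (fun i => (hm i).comap_le) hindep hST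
  exact (IndepFun_iff_Indep _ _ _).2
    (indep_of_indep_of_le_left (indep_of_indep_of_le_right h hg.comap_le) hf.comap_le)

theorem measurable_iSup_comap {Ω : Type*} (Z : ℕ → Ω → ℝ) {S : Set ℕ} {i : ℕ} (hi : i ∈ S) :
    Measurable[⨆ i ∈ S, MeasurableSpace.comap (Z i) inferInstance] (Z i) :=
  (comap_measurable (Z i)).mono
    (le_iSup₂ (f := fun i (_ : i ∈ S) => MeasurableSpace.comap (Z i) inferInstance) i hi) le_rfl

theorem ae_summable_mul_abs (hlaw : ∀ n, HasLaw (Z n) (gaussianReal 0 1) P)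
    (hα : ∀ n, 0 ≤ α n) (hs : Summable α) : ∀ᵐ ω ∂P, Summable fun n => α n * |Z n ω| := by
  set C := ∫⁻ z, ENNReal.ofReal |z| ∂(gaussianReal 0 1) with hC
  have hCfin : C ≠ ⊤ := by
    have h : Integrable (fun z : ℝ => |z|) (gaussianReal 0 1) := by
      refine Integrable.mono' (integrable_exp_mul_abs_gaussian 1) (by fun_prop)
        (ae_of_all _ fun z => ?_)
      rw [Real.norm_of_nonneg (abs_nonneg z), one_mul]
      linarith [add_one_le_exp |z|]
    exact ((hasFiniteIntegral_iff_ofReal (ae_of_all _ fun z => abs_nonneg z)).1 h.2).ne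
  have hterm : ∀ n, ∫⁻ ω, ENNReal.ofReal (α n * |Z n ω|) ∂P = ENNReal.ofReal (α n) * C := fun n => by
    rw [(hlaw n).lintegral_comp (f := fun z => ENNReal.ofReal (α n * |z|)) (by fun_prop), hC,
      ← lintegral_const_mul _ (by fun_prop)]
    exact lintegral_congr fun z => ENNReal.ofReal_mul (hα n)
  have hae : ∀ n, AEMeasurable (fun ω => ENNReal.ofReal (α n * |Z n ω|)) P := fun n =>
    ENNReal.measurable_ofReal.comp_aemeasurable (((hlaw n).aemeasurable.abs).const_mul (α n))
  have htot : ∫⁻ ω, ∑' n, ENNReal.ofReal (α n * |Z n ω|) ∂P ≠ ⊤ := by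
    rw [lintegral_tsum hae]
    simp_rw [hterm]
    rw [ENNReal.tsum_mul_right]
    exact ENNReal.mul_ne_top hs.tsum_ofReal_ne_top hCfin
  filter_upwards [ae_lt_top' (AEMeasurable.tsum hae) htot] with ω hω
  have := ENNReal.summable_toReal hω.ne
  refine this.congr fun n => ?_
  exact ENNReal.toReal_ofReal (mul_nonneg (hα n) (abs_nonneg _))

theorem mgf_mul_abs (hlaw : ∀ n, HasLaw (Z n) (gaussianReal 0 1) P) (hα : ∀ n, 0 ≤ α n)
    {t : ℝ} (ht : 0 ≤ t) (n : ℕ) :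
    Integrable (fun ω => exp (t * (α n * |Z n ω|))) P ∧
    mgf (fun ω => α n * |Z n ω|) P t = exp (t ^ 2 * α n ^ 2 / 2 + logTwoPhi (t * α n)) := by
  have hi := integrable_exp_mul_abs_gaussian (t * α n)
  constructor
  · have h : Integrable (fun z => exp (t * α n * |z|)) (P.map (Z n)) := by
      rwa [(hlaw n).map_eq]
    refine (h.comp_aemeasurable (hlaw n).aemeasurable).congr (ae_of_all _ fun ω => ?_)
    simp only [Function.comp, mul_assoc]
  · have h := (hlaw n).integral_comp hi.1
    rw [integral_exp_mul_abs_gaussian] at h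
    rw [exp_add, exp_logTwoPhi (mul_nonneg ht (hα n)), ← mul_pow, ← h, mgf]
    simp only [Function.comp, mul_assoc]

/-- The moment generating function of `∑ αₙ |Zₙ|` on the positive half-line. -/
theorem mgf_absSum (hindep : iIndepFun Z P) (hlaw : ∀ n, HasLaw (Z n) (gaussianReal 0 1) P)
    (hm : ∀ n, Measurable (Z n)) (hα : ∀ n, 0 ≤ α n) (hs : Summable α)
    (hs2 : Summable fun n => α n ^ 2) {t : ℝ} (ht : 0 ≤ t) :
    Integrable (fun ω => exp (t * absSum Z α ω)) P ∧
    mgf (absSum Z α) P t = exp (t ^ 2 * (∑' n, α n ^ 2) / 2 + logProdTwoPhi α t) := by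
  have := hindep.isProbabilityMeasure
  set Y : ℕ → Ω → ℝ := fun n ω => α n * |Z n ω| with hY
  have hYm : ∀ n, Measurable (Y n) := fun n => (hm n).abs.const_mul _
  have hYi : iIndepFun Y P := hindep.comp (fun n x => α n * |x|) fun n => by fun_prop
  have hint : ∀ M, Integrable (fun ω => exp (t * (∑ n ∈ Finset.range M, Y n) ω)) P := fun M =>
    hYi.integrable_exp_mul_sum hYm fun n _ => (mgf_mul_abs hlaw hα ht n).1
  have hval : ∀ M, mgf (∑ n ∈ Finset.range M, Y n) P t
      = exp (∑ n ∈ Finset.range M, (t ^ 2 / 2 * α n ^ 2 + logTwoPhi (t * α n))) := fun M => by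
    rw [hYi.mgf_sum hYm, exp_sum]
    refine Finset.prod_congr rfl fun n _ => ?_
    rw [hY, (mgf_mul_abs hlaw hα ht n).2]
    congr 2
    ring
  have hlim : Tendsto (fun M => mgf (∑ n ∈ Finset.range M, Y n) P t) atTop
      (𝓝 (exp (t ^ 2 * (∑' n, α n ^ 2) / 2 + logProdTwoPhi α t))) := by
    simp_rw [hval]
    have h := ((hs2.mul_left (t ^ 2 / 2)).hasSum.add
      (summable_logTwoPhi hα hs ht).hasSum).tendsto_sum_nat
    rw [tsum_mul_left, show t ^ 2 / 2 * ∑' n, α n ^ 2 = t ^ 2 * (∑' n, α n ^ 2) / 2 by ring] at h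
    exact (continuous_exp.tendsto _).comp h
  have hRm := measurable_absSum hα hm
  have hRexp : Measurable fun ω => exp (t * absSum Z α ω) := (hRm.const_mul t).exp
  have hl : ∫⁻ ω, ENNReal.ofReal (exp (t * absSum Z α ω)) ∂P
      = ENNReal.ofReal (exp (t ^ 2 * (∑' n, α n ^ 2) / 2 + logProdTwoPhi α t)) := by
    -- Monotone convergence in [0, ∞] gives integrability and the value together.
    have h1 := lintegral_tendsto_of_tendsto_of_monotone (μ := P)
      (f := fun M ω => ENNReal.ofReal (exp (t * (∑ n ∈ Finset.range M, Y n) ω)))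
      (F := fun ω => ENNReal.ofReal (exp (t * absSum Z α ω)))
      (fun M => (hint M).1.aemeasurable.ennreal_ofReal)
      (ae_of_all _ fun ω M M' hMM' => by
        refine ENNReal.ofReal_le_ofReal (exp_le_exp.2 (mul_le_mul_of_nonneg_left ?_ ht))
        simp only [Finset.sum_apply]
        exact Finset.sum_le_sum_of_subset_of_nonneg (Finset.range_mono hMM')
          fun n _ _ => mul_nonneg (hα n) (abs_nonneg _))
      (by
        filter_upwards [ae_summable_mul_abs hlaw hα hs] with ω hω
        have := hω.hasSum.tendsto_sum_nat
        refine (ENNReal.continuous_ofReal.tendsto _).comp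
          ((continuous_exp.tendsto _).comp (Tendsto.const_mul t ?_))
        simp only [Finset.sum_apply]
        exact this)
    refine tendsto_nhds_unique h1 (((ENNReal.continuous_ofReal.tendsto _).comp hlim).congr
      fun M => ?_)
    exact ofReal_integral_eq_lintegral_ofReal (hint M) (ae_of_all _ fun ω => (exp_pos _).le)
  constructor
  · refine ⟨hRexp.aestronglyMeasurable, ?_⟩
    rw [hasFiniteIntegral_iff_ofReal (ae_of_all _ fun ω => (exp_pos _).le), hl]
    exact ENNReal.ofReal_lt_top
  · rw [mgf, integral_eq_lintegral_of_nonneg_ae (ae_of_all _ fun ω => (exp_pos _).le)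
      hRexp.aestronglyMeasurable, hl, ENNReal.toReal_ofReal (exp_pos _).le]

theorem hasLaw_linSum (hindep : iIndepFun Z P) (hlaw : ∀ n, HasLaw (Z n) (gaussianReal 0 1) P)
    (hm : ∀ n, Measurable (Z n)) (α : ℕ → ℝ) (k : ℕ) :
    HasLaw (linSum Z α k) (gaussianReal 0 (∑ n ∈ Finset.range k, (α n ^ 2).toNNReal)) P := by
  have := hindep.isProbabilityMeasure
  induction k with
  | zero =>
    simp only [Finset.range_zero, Finset.sum_empty, gaussianReal_zero_var]
    exact hasLaw_dirac_of_ae_eq (ae_of_all _ fun ω => by simp [linSum])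
  | succ k ih =>
    refine ⟨(measurable_linSum α fun n _ => hm n).aemeasurable, ?_⟩
    have hind : IndepFun (linSum Z α k) (fun ω => α k * Z k ω) P :=
      iIndepFun.indepFun_of_disjoint hindep hm (S := Set.Iio k) (T := {k}) (by simp)
        (measurable_linSum (m := ⨆ i ∈ Set.Iio k, MeasurableSpace.comap (Z i) inferInstance) α
          fun n hn => measurable_iSup_comap Z hn)
        ((measurable_iSup_comap Z (Set.mem_singleton k)).const_mul (α k))
    have h := gaussianReal_add_gaussianReal_of_indepFun hind ih.map_eq
      (gaussianReal_const_mul (hlaw k) (α k)).map_eq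
    have e : linSum Z α (k + 1) = linSum Z α k + fun ω => α k * Z k ω := by
      funext ω
      simp [linSum, Finset.sum_range_succ]
    rw [e, h, Finset.sum_range_succ]
    congr 1
    · simp
    · congr 1
      rw [mul_one]
      exact (Real.toNNReal_of_nonneg (sq_nonneg _)).symm

/-- The case l = k + 1 leaves out Zₖ, as the reflection error needs. -/
theorem indepFun_linSum_absSum (hindep : iIndepFun Z P) (hm : ∀ n, Measurable (Z n))
    (hα : ∀ n, 0 ≤ α n) {k l : ℕ} (hkl : k ≤ l) :
    IndepFun (linSum Z α k) (absSum (fun n => Z (n + l)) fun n => α (n + l)) P :=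
  iIndepFun.indepFun_of_disjoint hindep hm (S := Set.Iio k) (T := Set.Ici l)
    (Set.disjoint_left.2 fun n h1 h2 => by simp only [Set.mem_Iio, Set.mem_Ici] at h1 h2; omega)
    (measurable_linSum (m := ⨆ i ∈ Set.Iio k, MeasurableSpace.comap (Z i) inferInstance) α
      fun n hn => measurable_iSup_comap Z hn)
    (measurable_absSum (m := ⨆ i ∈ Set.Ici l, MeasurableSpace.comap (Z i) inferInstance)
      (fun n => hα _) fun n => measurable_iSup_comap Z (Set.mem_Ici.2 (Nat.le_add_left l n)))

theorem indepFun_linSum_add_absSum (hindep : iIndepFun Z P) (hm : ∀ n, Measurable (Z n))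
    (hα : ∀ n, 0 ≤ α n) (k : ℕ) :
    IndepFun (Z k) (fun ω => linSum Z α k ω
      + absSum (fun n => Z (n + (k + 1))) (fun n => α (n + (k + 1))) ω) P := by
  refine iIndepFun.indepFun_of_disjoint hindep hm (S := {k}) (T := {k}ᶜ) disjoint_compl_right
    (measurable_iSup_comap Z (Set.mem_singleton k)) ?_
  refine Measurable.add
    (measurable_linSum (m := ⨆ i ∈ ({k}ᶜ : Set ℕ), MeasurableSpace.comap (Z i) inferInstance) α
      fun n hn => measurable_iSup_comap Z ?_)
    (measurable_absSum (m := ⨆ i ∈ ({k}ᶜ : Set ℕ), MeasurableSpace.comap (Z i) inferInstance)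
      (fun n => hα _) fun n => measurable_iSup_comap Z ?_)
  · exact hn.ne
  · simp only [Set.mem_compl_iff, Set.mem_singleton_iff]; omega

end Sequence

/-! ### Exact tail asymptotics through hybrid sums. -/

/-- The tail asymptotics of `∑_{n<k} αₙ Zₙ + ∑_{n≥k} αₙ |Zₙ|` when `∑ αₙ² = 1`. -/
noncomputable def tailAsymp (α : ℕ → ℝ) (k : ℕ) (r : ℝ) : ℝ :=
  exp (-r ^ 2 / 2) / (r * √(2 * π)) * exp (logProdTwoPhi (fun n => α (n + k)) r)

/-- The tail of the hybrid sum `∑_{n<k} αₙ Zₙ + ∑_{n≥k} αₙ |Zₙ|`. -/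
noncomputable def hybridTail {Ω : Type*} [MeasurableSpace Ω] (P : Measure Ω) (Z : ℕ → Ω → ℝ)
    (α : ℕ → ℝ) (k : ℕ) (r : ℝ) : ℝ :=
  P.real {ω | r ≤ linSum Z α k ω + absSum (fun n => Z (n + k)) (fun n => α (n + k)) ω}

/-- The variance of the Gaussian part of the hybrid sum. -/
noncomputable def partVar (α : ℕ → ℝ) (k : ℕ) : ℝ≥0 := ∑ n ∈ Finset.range k, (α n ^ 2).toNNReal

theorem coe_partVar (α : ℕ → ℝ) (k : ℕ) : (partVar α k : ℝ) = ∑ n ∈ Finset.range k, α n ^ 2 := by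
  simp only [partVar, NNReal.coe_sum, Real.coe_toNNReal _ (sq_nonneg _)]

theorem partVar_succ_pos {α : ℕ → ℝ} (hα : ∀ n, 0 < α n) (k : ℕ) : 0 < (partVar α (k + 1) : ℝ) := by
  rw [coe_partVar]
  exact Finset.sum_pos (fun n _ => pow_pos (hα n) 2) ⟨0, by simp⟩

theorem tailAsymp_pos (α : ℕ → ℝ) (k : ℕ) {r : ℝ} (hr : 0 < r) : 0 < tailAsymp α k r := by
  unfold tailAsymp
  positivity

theorem tailAsymp_succ {α : ℕ → ℝ} (hα : ∀ n, 0 ≤ α n) (hs : Summable α) (k : ℕ) {r : ℝ}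
    (hr : 0 ≤ r) : tailAsymp α k r = twoPhi (r * α k) * tailAsymp α (k + 1) r := by
  have h := summable_logTwoPhi (fun n => hα (n + k)) ((summable_nat_add_iff k).2 hs) hr
  unfold tailAsymp logProdTwoPhi
  rw [h.tsum_eq_zero_add, zero_add, exp_add, exp_logTwoPhi (mul_nonneg hr (hα k))]
  simp only [add_assoc, add_comm 1 k]
  ring

section Tail

variable {Ω : Type*} [MeasurableSpace Ω] {P : Measure Ω}
  {Z : ℕ → Ω → ℝ} {α : ℕ → ℝ}

theorem mgf_absSum_nat_add (hindep : iIndepFun Z P)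
    (hlaw : ∀ n, HasLaw (Z n) (gaussianReal 0 1) P) (hm : ∀ n, Measurable (Z n))
    (hα : ∀ n, 0 ≤ α n) (hs : Summable α) (h1 : HasSum (fun n => α n ^ 2) 1)
    (k : ℕ) {t : ℝ} (ht : 0 ≤ t) :
    Integrable (fun ω => exp (t * absSum (fun n => Z (n + k)) (fun n => α (n + k)) ω)) P ∧
    mgf (absSum (fun n => Z (n + k)) fun n => α (n + k)) P t
      = exp (t ^ 2 * (1 - partVar α k) / 2 + logProdTwoPhi (fun n => α (n + k)) t) := by
  have hτ : ∑' n, α (n + k) ^ 2 = 1 - partVar α k := by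
    rw [coe_partVar, ← h1.tsum_eq, ← h1.summable.sum_add_tsum_nat_add k]
    ring
  rw [← hτ]
  exact mgf_absSum (hindep.precomp (add_left_injective k)) (fun n => hlaw _) (fun n => hm _)
    (fun n => hα _) ((summable_nat_add_iff k).2 hs)
    ((summable_nat_add_iff (f := fun n => α n ^ 2) k).2 h1.summable) ht

/-- The exponent r²v/2 - r² from the Gaussian part and r²(1 - v)/2 from the remainder add up to
-r²/2, whatever k is; only √v remembers the split. -/
theorem hybridTail_le (hindep : iIndepFun Z P) (hlaw : ∀ n, HasLaw (Z n) (gaussianReal 0 1) P)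
    (hm : ∀ n, Measurable (Z n)) (hα : ∀ n, 0 < α n) (hs : Summable α)
    (h1 : HasSum (fun n => α n ^ 2) 1) (k : ℕ) {r : ℝ} (hr : 0 < r) :
    hybridTail P Z α (k + 1) r ≤ (√(partVar α (k + 1)))⁻¹ * tailAsymp α (k + 1) r := by
  have := hindep.isProbabilityMeasure
  have hα' : ∀ n, 0 ≤ α n := fun n => (hα n).le
  have hv := partVar_succ_pos hα k
  obtain ⟨hi, he⟩ := mgf_absSum_nat_add hindep hlaw hm hα' hs h1 (k + 1) hr.le
  refine (measureReal_gaussian_add_ge_le (NNReal.coe_ne_zero.1 hv.ne')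
    (hasLaw_linSum hindep hlaw hm α (k + 1)) (measurable_absSum (fun n => hα' _) fun n => hm _)
    (indepFun_linSum_absSum hindep hm hα' le_rfl) hr hi).trans_eq ?_
  rw [he, tailAsymp, Real.sqrt_mul (by positivity), exp_add]
  have : exp (-r ^ 2 / 2) = exp (r ^ 2 * (partVar α (k + 1)) / 2 - r ^ 2)
      * exp (r ^ 2 * (1 - partVar α (k + 1)) / 2) := by
    rw [← exp_add]; congr 1; ring
  rw [this]
  field_simp

theorem le_hybridTail (hindep : iIndepFun Z P) (hlaw : ∀ n, HasLaw (Z n) (gaussianReal 0 1) P)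
    (hm : ∀ n, Measurable (Z n)) (hα : ∀ n, 0 < α n) (hs : Summable α)
    (h1 : HasSum (fun n => α n ^ 2) 1) (k : ℕ) {r : ℝ} (hr : 1 ≤ r) :
    (√(partVar α (k + 1)))⁻¹ * (1 - (2 / r ^ 2 + 2 * (exp ((1 - partVar α (k + 1)) / 2
      + ∑' n, α (n + (k + 1))) - 1)) / partVar α (k + 1)) * tailAsymp α (k + 1) r
      ≤ hybridTail P Z α (k + 1) r := by
  have := hindep.isProbabilityMeasure
  have hα' : ∀ n, 0 ≤ α n := fun n => (hα n).le
  have hr0 : 0 < r := by linarith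
  have hv := partVar_succ_pos hα k
  have hs' : Summable fun n => α (n + (k + 1)) := (summable_nat_add_iff (k + 1)).2 hs
  obtain ⟨hi, he⟩ := mgf_absSum_nat_add hindep hlaw hm hα' hs h1 (k + 1) hr0.le
  obtain ⟨hi1, he1⟩ := mgf_absSum_nat_add hindep hlaw hm hα' hs h1 (k + 1)
    (t := r + 1) (by linarith)
  obtain ⟨hi2, he2⟩ := mgf_absSum_nat_add hindep hlaw hm hα' hs h1 (k + 1)
    (t := r - 1) (by linarith)
  refine le_trans ?_ (le_measureReal_gaussian_add_ge (NNReal.coe_ne_zero.1 hv.ne')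
    (hasLaw_linSum hindep hlaw hm α (k + 1)) (measurable_absSum (fun n => hα' _) fun n => hm _)
    (indepFun_linSum_absSum hindep hm hα' le_rfl) hr0 (τ := 1 - partVar α (k + 1))
    (add_sub_cancel _ _) hi hi1 hi2)
  change _ ≤ (√(2 * π * partVar α (k + 1)))⁻¹ * exp (r ^ 2 * partVar α (k + 1) / 2 - r ^ 2) / r * _
  have hL1 := logProdTwoPhi_add_one_sub_le (fun n => hα' (n + (k + 1))) hs' hr0.le
  have hL2 := logProdTwoPhi_mono (fun n => hα' (n + (k + 1))) hs'
    (show 0 ≤ r - 1 by linarith) (show r - 1 ≤ r by linarith)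
  have hσ : 0 ≤ ∑' n, α (n + (k + 1)) := tsum_nonneg fun n => hα' _
  set σ := ∑' n, α (n + (k + 1))
  set v : ℝ := (partVar α (k + 1) : ℝ) with hvdef
  set L := logProdTwoPhi fun n => α (n + (k + 1))
  set M := mgf (absSum (fun n => Z (n + (k + 1))) fun n => α (n + (k + 1))) P
  -- Shifting the tilt by ±1 changes the quadratic exponent by ±r(1 - v) + (1 - v)/2; the prefactor
  -- cancels the first part, and the log-product grows by at most σ.
  have b1 : exp (-(r * (1 - v))) * M (r + 1) ≤ M r * exp ((1 - v) / 2 + σ) := by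
    rw [he, he1, ← exp_add, ← exp_add, exp_le_exp]
    nlinarith
  have b2 : exp (r * (1 - v)) * M (r - 1) ≤ M r * exp ((1 - v) / 2 + σ) := by
    rw [he, he2, ← exp_add, ← exp_add, exp_le_exp]
    nlinarith
  have e : (√v)⁻¹ * (1 - (2 / r ^ 2 + 2 * (exp ((1 - v) / 2 + σ) - 1)) / v) * tailAsymp α (k + 1) r
      = (√(2 * π * v))⁻¹ * exp (r ^ 2 * v / 2 - r ^ 2) / r *
        (M r - (2 / r ^ 2 * M r + (M r * exp ((1 - v) / 2 + σ) + M r * exp ((1 - v) / 2 + σ)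
          - 2 * M r)) / v) := by
    have e1 : (√(2 * π * v))⁻¹ * exp (r ^ 2 * v / 2 - r ^ 2) / r * M r
        = (√v)⁻¹ * tailAsymp α (k + 1) r := by
      rw [he, tailAsymp, Real.sqrt_mul (by positivity), exp_add]
      have : exp (-r ^ 2 / 2) = exp (r ^ 2 * v / 2 - r ^ 2) * exp (r ^ 2 * (1 - v) / 2) := by
        rw [← exp_add]; congr 1; ring
      rw [this]
      field_simp
      rfl
    calc _ = (√v)⁻¹ * tailAsymp α (k + 1) r
          * (1 - (2 / r ^ 2 + 2 * (exp ((1 - v) / 2 + σ) - 1)) / v) := by ring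
      _ = _ := by rw [← e1]; ring
  rw [e]
  gcongr

/-- The reflection error is the tail of the sum without Zₖ. Its squared weights add up to 1 - αₖ²,
so Chernoff's bound at r gains exp(-αₖ²r²/2), at the price of the prefactor r√(2π). -/
theorem abs_hybridTail_sub_le (hindep : iIndepFun Z P)
    (hlaw : ∀ n, HasLaw (Z n) (gaussianReal 0 1) P) (hm : ∀ n, Measurable (Z n))
    (hα : ∀ n, 0 < α n) (hs : Summable α) (h1 : HasSum (fun n => α n ^ 2) 1)
    (k : ℕ) {r : ℝ} (hr : 0 < r) :
    |hybridTail P Z α k r - 2 * hybridTail P Z α (k + 1) r|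
      ≤ √(2 * π) * (r * exp (-(α k ^ 2 / 2 * r ^ 2))) * tailAsymp α (k + 1) r := by
  have := hindep.isProbabilityMeasure
  have hα' : ∀ n, 0 ≤ α n := fun n => (hα n).le
  set R := absSum (fun n => Z (n + (k + 1))) fun n => α (n + (k + 1)) with hRdef
  set W : Ω → ℝ := fun ω => linSum Z α k ω + R ω with hW
  have hRm : Measurable R := measurable_absSum (fun n => hα' _) fun n => hm _
  have hGm : Measurable (linSum Z α k) := measurable_linSum α fun n _ => hm n
  have hneg : HasLaw (-Z k) (gaussianReal 0 1) P := by
    simpa using gaussianReal_neg (hlaw k)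
  have href := abs_measureReal_abs_add_sub_le (hlaw k) hneg (hm k) (hGm.add hRm)
    (indepFun_linSum_add_absSum hindep hm hα' k) (hα' k) r
  have e0 : hybridTail P Z α k r = P.real {ω | r ≤ α k * |Z k ω| + W ω} := by
    refine measureReal_congr ?_
    filter_upwards [ae_summable_mul_abs hlaw hα' hs] with ω hω
    have hsum := ((summable_nat_add_iff k).2 hω).tsum_eq_zero_add
    have : absSum (fun n => Z (n + k)) (fun n => α (n + k)) ω = α k * |Z k ω| + R ω := by
      rw [absSum, hsum, hRdef, absSum, zero_add]
      simp only [add_assoc, add_comm 1 k]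
    have h2 : linSum Z α k ω + absSum (fun n => Z (n + k)) (fun n => α (n + k)) ω
        = α k * |Z k ω| + W ω := by rw [this, hW]; ring
    change (r ≤ _) = (r ≤ _)
    rw [h2]
  have e1 : hybridTail P Z α (k + 1) r = P.real {ω | r ≤ α k * Z k ω + W ω} := by
    unfold hybridTail
    congr 1
    ext ω
    have : linSum Z α (k + 1) ω + R ω = α k * Z k ω + W ω := by
      simp only [hW, linSum, Finset.sum_range_succ]; ring
    simp only [Set.mem_ofPred_eq]
    rw [← this]
  rw [e0, e1]
  refine href.trans ?_
  obtain ⟨hi, he⟩ := mgf_absSum_nat_add hindep hlaw hm hα' hs h1 (k + 1) hr.le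
  have hlawG := hasLaw_linSum hindep hlaw hm α k
  have hind := indepFun_linSum_absSum hindep hm hα' (Nat.le_succ k)
  have hGi : Integrable (fun ω => exp (r * linSum Z α k ω)) P := by
    have h : Integrable (fun z => exp (r * z)) (P.map (linSum Z α k)) := by
      rw [hlawG.map_eq]; exact integrable_exp_mul_gaussianReal r
    exact h.comp_aemeasurable hlawG.aemeasurable
  have hch := measure_ge_le_exp_mul_mgf (X := linSum Z α k + R) (μ := P) r hr.le
    (hind.integrable_exp_mul_add hGi hi)
  refine hch.trans_eq ?_
  rw [hind.mgf_add hGi.1 hi.1, mgf_gaussianReal hlawG.map_eq, he, tailAsymp]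
  have hv : (partVar α (k + 1) : ℝ) = partVar α k + α k ^ 2 := by
    rw [coe_partVar, coe_partVar, Finset.sum_range_succ]
  change _ * (exp (0 * r + (partVar α k : ℝ) * r ^ 2 / 2) * _) = _
  rw [hv]
  have hc : √(2 * π) * (r * exp (-(α k ^ 2 / 2 * r ^ 2))) * (exp (-r ^ 2 / 2) / (r * √(2 * π)) *
      exp (logProdTwoPhi (fun n => α (n + (k + 1))) r)) = exp (-(α k ^ 2 / 2 * r ^ 2)) *
      (exp (-r ^ 2 / 2) * exp (logProdTwoPhi (fun n => α (n + (k + 1))) r)) := by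
    field_simp
  rw [hc, ← exp_add, ← exp_add, ← exp_add, ← exp_add]
  congr 1
  ring

theorem tendsto_mul_exp_neg_mul_sq {c : ℝ} (hc : 0 < c) :
    Tendsto (fun r : ℝ => r * exp (-(c * r ^ 2))) atTop (𝓝 0) := by
  have h1 : Tendsto (fun r : ℝ => c * r ^ 2) atTop atTop :=
    (tendsto_pow_atTop two_ne_zero).const_mul_atTop hc
  have h2 := ((tendsto_pow_mul_exp_neg_atTop_nhds_zero 1).comp h1).const_mul (1 / c)
  rw [mul_zero] at h2
  refine squeeze_zero' (eventually_ge_atTop 0 |>.mono fun r hr => by positivity) ?_ h2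
  filter_upwards [eventually_ge_atTop 1] with r hr
  simp only [Function.comp, pow_one]
  rw [← mul_assoc, show 1 / c * (c * r ^ 2) = r ^ 2 by field_simp]
  gcongr
  nlinarith

/-- Passing from k to k + 1 halves the tail up to the reflection error and removes 2Φ(rαₖ) → 2 from
the prediction; the bound `hybridTail_le` keeps the mismatch |2 - 2Φ(rαₖ)| negligible. -/
theorem tendsto_hybridTail_div_sub (hindep : iIndepFun Z P)
    (hlaw : ∀ n, HasLaw (Z n) (gaussianReal 0 1) P) (hm : ∀ n, Measurable (Z n))
    (hα : ∀ n, 0 < α n) (hs : Summable α) (h1 : HasSum (fun n => α n ^ 2) 1) (k : ℕ) :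
    Tendsto (fun r => hybridTail P Z α k r / tailAsymp α k r
      - hybridTail P Z α (k + 1) r / tailAsymp α (k + 1) r) atTop (𝓝 0) := by
  have hα' : ∀ n, 0 ≤ α n := fun n => (hα n).le
  have hφ : Tendsto (fun r => twoPhi (r * α k)) atTop (𝓝 2) :=
    tendsto_twoPhi_atTop.comp (tendsto_id.atTop_mul_const (hα k))
  have hE := (tendsto_mul_exp_neg_mul_sq (c := α k ^ 2 / 2) (by have := hα k; positivity)).const_mul
    √(2 * π)
  have hB := (hE.add ((hφ.const_sub 2).abs.const_mul (√(partVar α (k + 1)))⁻¹))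
  simp only [sub_self, abs_zero, mul_zero, add_zero] at hB
  refine squeeze_zero_norm' ?_ hB
  filter_upwards [eventually_gt_atTop 0] with r hr
  have hD := tailAsymp_pos α (k + 1) hr
  have h2 := abs_hybridTail_sub_le hindep hlaw hm hα hs h1 k hr
  have h3 := hybridTail_le hindep hlaw hm hα hs h1 k hr
  have hf0 : 0 ≤ hybridTail P Z α (k + 1) r := measureReal_nonneg
  have hφ1 := one_le_twoPhi (mul_nonneg hr.le (hα' k))
  rw [tailAsymp_succ hα' hs k hr.le, Real.norm_eq_abs]
  set f := hybridTail P Z α k r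
  set g := hybridTail P Z α (k + 1) r
  set D := tailAsymp α (k + 1) r
  set p := twoPhi (r * α k)
  have hp : 0 < p := by linarith
  have e : f / (p * D) - g / D = ((f - 2 * g) + (2 - p) * g) / (p * D) := by
    field_simp
    ring
  rw [e, abs_div, abs_of_pos (mul_pos hp hD), div_le_iff₀ (mul_pos hp hD)]
  have hb : |(f - 2 * g) + (2 - p) * g| ≤ (√(2 * π) * (r * exp (-(α k ^ 2 / 2 * r ^ 2)))
      + (√(partVar α (k + 1)))⁻¹ * |2 - p|) * D := by
    refine (abs_add_le _ _).trans ?_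
    rw [abs_mul, abs_of_nonneg hf0]
    have := mul_le_mul_of_nonneg_left h3 (abs_nonneg (2 - p))
    linarith
  refine hb.trans ?_
  have h0 : 0 ≤ √(2 * π) * (r * exp (-(α k ^ 2 / 2 * r ^ 2)))
      + (√(partVar α (k + 1)))⁻¹ * |2 - p| := by positivity
  exact mul_le_mul_of_nonneg_left (le_mul_of_one_le_left hD.le hφ1) h0

/-- Exact tail asymptotics of `∑ αₙ |Zₙ|` for a sequence of unit `ℓ²` norm. -/
theorem tendsto_tail_div (hindep : iIndepFun Z P)
    (hlaw : ∀ n, HasLaw (Z n) (gaussianReal 0 1) P) (hm : ∀ n, Measurable (Z n))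
    (hα : ∀ n, 0 < α n) (hs : Summable α) (h1 : HasSum (fun n => α n ^ 2) 1) :
    Tendsto (fun r => P.real {ω | r ≤ absSum Z α ω} / tailAsymp α 0 r) atTop (𝓝 1) := by
  have h0 : ∀ r, P.real {ω | r ≤ absSum Z α ω} = hybridTail P Z α 0 r := fun r => by
    simp [hybridTail, linSum]
  simp_rw [h0]
  have htel : ∀ k, Tendsto (fun r => hybridTail P Z α 0 r / tailAsymp α 0 r
      - hybridTail P Z α k r / tailAsymp α k r) atTop (𝓝 0) := fun k => by
    induction k with
    | zero => simp
    | succ k ih =>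
      have := ih.add (tendsto_hybridTail_div_sub hindep hlaw hm hα hs h1 k)
      rw [add_zero] at this
      exact this.congr fun r => by ring
  have hv : Tendsto (fun k => (partVar α (k + 1) : ℝ)) atTop (𝓝 1) := by
    simp_rw [coe_partVar]
    exact h1.tendsto_sum_nat.comp (tendsto_add_atTop_nat 1)
  have hσ : Tendsto (fun k => ∑' n, α (n + (k + 1))) atTop (𝓝 0) :=
    (tendsto_sum_nat_add α).comp (tendsto_add_atTop_nat 1)
  have hup : Tendsto (fun k => (√(partVar α (k + 1)))⁻¹) atTop (𝓝 1) := by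
    have := (hv.sqrt).inv₀ (by simp)
    simpa using this
  have hlo : Tendsto (fun k => (√(partVar α (k + 1)))⁻¹ *
      (1 - (2 * (exp ((1 - partVar α (k + 1)) / 2 + ∑' n, α (n + (k + 1))) - 1))
        / partVar α (k + 1))) atTop (𝓝 1) := by
    have := hup.mul ((((((((hv.const_sub 1).div_const 2).add hσ).rexp).sub_const 1).const_mul
      2).div hv one_ne_zero).const_sub 1)
    simpa using this
  rw [Metric.tendsto_nhds]
  intro δ hδ
  -- First fix k so that both limiting constants are within δ/2 of 1, then let r → ∞.
  obtain ⟨k, hk1, hk2⟩ := ((hup.eventually (gt_mem_nhds (show (1 : ℝ) < 1 + δ / 2 by linarith))).and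
    (hlo.eventually (lt_mem_nhds (show 1 - δ / 2 < (1 : ℝ) by linarith)))).exists
  have hlor : Tendsto (fun r : ℝ => (√(partVar α (k + 1)))⁻¹ * (1 - (2 / r ^ 2 +
      2 * (exp ((1 - partVar α (k + 1)) / 2 + ∑' n, α (n + (k + 1))) - 1)) / partVar α (k + 1)))
      atTop (𝓝 ((√(partVar α (k + 1)))⁻¹ *
      (1 - (2 * (exp ((1 - partVar α (k + 1)) / 2 + ∑' n, α (n + (k + 1))) - 1))
        / partVar α (k + 1)))) := by
    have hz : Tendsto (fun r : ℝ => 2 / r ^ 2) atTop (𝓝 0) :=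
      tendsto_const_nhds.div_atTop (tendsto_pow_atTop two_ne_zero)
    have := (((hz.add_const (2 * (exp ((1 - (partVar α (k + 1) : ℝ)) / 2
      + ∑' n, α (n + (k + 1))) - 1))).div_const (partVar α (k + 1) : ℝ)).const_sub 1).const_mul
      (√(partVar α (k + 1)))⁻¹
    rwa [zero_add] at this
  filter_upwards [Metric.tendsto_nhds.1 (htel (k + 1)) (δ / 2) (by positivity),
    hlor.eventually (lt_mem_nhds hk2), eventually_ge_atTop 1] with r hr1 hr2 hr
  have hr0 : 0 < r := by linarith
  have hD := tailAsymp_pos α (k + 1) hr0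
  have u := hybridTail_le hindep hlaw hm hα hs h1 k hr0
  have l := le_hybridTail hindep hlaw hm hα hs h1 k hr
  rw [← div_le_iff₀ hD] at u
  rw [← le_div_iff₀ hD] at l
  rw [Real.dist_eq, sub_zero, abs_lt] at hr1
  rw [Real.dist_eq, abs_lt]
  constructor <;> linarith [hr1.1, hr1.2]

end Tail

/-! ### Normalisation and conclusion. -/

theorem tsum_sq_pos {a : ℕ → ℝ} (ha : ∀ n, 0 < a n) (hs : Summable fun n => a n ^ 2) :
    0 < ∑' n, a n ^ 2 :=
  hs.tsum_pos (fun _ => sq_nonneg _) 0 (pow_pos (ha 0) 2)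

theorem Summable.sq_of_nonneg {a : ℕ → ℝ} (ha : ∀ n, 0 ≤ a n) (hs : Summable a) :
    Summable fun n => a n ^ 2 := by
  refine Summable.of_norm_bounded_eventually_nat hs ?_
  filter_upwards [hs.tendsto_atTop_zero.eventually (gt_mem_nhds one_pos)] with n hn
  rw [Real.norm_of_nonneg (sq_nonneg _)]
  nlinarith [ha n]

theorem l2Norm_pos {a : ℕ → ℝ} (ha : ∀ n, 0 < a n) (hs : Summable a) : 0 < l2Norm a :=
  Real.sqrt_pos.2 (tsum_sq_pos ha (hs.sq_of_nonneg fun n => (ha n).le))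

theorem hasSum_div_l2Norm_sq {a : ℕ → ℝ} (ha : ∀ n, 0 < a n) (hs : Summable a) :
    HasSum (fun n => (a n / l2Norm a) ^ 2) 1 := by
  have h2 := hs.sq_of_nonneg fun n => (ha n).le
  have hN : l2Norm a ^ 2 = ∑' n, a n ^ 2 := Real.sq_sqrt (tsum_sq_pos ha h2).le
  have h := h2.hasSum.div_const (l2Norm a ^ 2)
  rw [← hN, div_self (hN ▸ tsum_sq_pos ha h2).ne'] at h
  simpa only [div_pow] using h

/-- Exact asymptotics of the upper tail. -/
theorem upperTail_isEquivalent {Ω : Type*} [MeasurableSpace Ω] {P : Measure Ω}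
    {Z : ℕ → Ω → ℝ} (hindep : iIndepFun Z P) (hlaw : ∀ n, HasLaw (Z n) (gaussianReal 0 1) P)
    {a : ℕ → ℝ} (ha : ∀ n, 0 < a n) (hs : Summable a) :
    (fun r => upperTail P Z a r) ~[atTop] tailAsymp (fun n => a n / l2Norm a) 0 := by
  have hN := l2Norm_pos ha hs
  have hZ : ∀ n, AEMeasurable (Z n) P := fun n => (hlaw n).aemeasurable
  -- `HasLaw` gives only a.e. measurability; measurable versions leave the tail unchanged.
  set Y : ℕ → Ω → ℝ := fun n => (hZ n).mk (Z n) with hY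
  have hYZ : ∀ n, Z n =ᵐ[P] Y n := fun n => (hZ n).ae_eq_mk
  have hlawY : ∀ n, HasLaw (Y n) (gaussianReal 0 1) P := fun n => (hlaw n).congr (hYZ n).symm
  set α : ℕ → ℝ := fun n => a n / l2Norm a with hαdef
  have hα : ∀ n, 0 < α n := fun n => div_pos (ha n) hN
  have hαs : Summable α := hs.div_const _
  have hT := tendsto_tail_div (hindep.congr hYZ) hlawY (fun n => (hZ n).measurable_mk) hα hαs
    (hasSum_div_l2Norm_sq ha hs)
  refine Asymptotics.isEquivalent_of_tendsto_one ?_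
  refine hT.congr' ?_
  filter_upwards [eventually_ge_atTop 0] with r hr
  simp only [Pi.div_apply]
  congr 1
  refine measureReal_congr ?_
  filter_upwards [ae_summable_mul_abs hlawY (fun n => (ha n).le) hs, ae_all_iff.2 hYZ] with ω hω hω'
  have hfin : ∑' n, ENNReal.ofReal (a n * |Z n ω|)
      = ENNReal.ofReal (l2Norm a * absSum Y α ω) := by
    have h0 : ∀ n, 0 ≤ a n * |Y n ω| := fun n => mul_nonneg (ha n).le (abs_nonneg _)
    have e : l2Norm a * absSum Y α ω = ∑' n, a n * |Y n ω| := by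
      rw [absSum, ← tsum_mul_left]
      refine tsum_congr fun n => ?_
      rw [hαdef]
      field_simp
    rw [e, ENNReal.ofReal_tsum_of_nonneg h0 hω]
    exact tsum_congr fun n => by rw [hω' n]
  change (r ≤ absSum Y α ω) = (ENNReal.ofReal (r * l2Norm a) ≤ _)
  have h0 : 0 ≤ absSum Y α ω := tsum_nonneg fun n => mul_nonneg (hα n).le (abs_nonneg _)
  rw [hfin, ENNReal.ofReal_le_ofReal_iff (mul_nonneg hN.le h0), mul_comm r,
    mul_le_mul_iff_right₀ hN]

theorem theorem2p1 {Ω : Type*} [MeasurableSpace Ω] (P : MeasureTheory.Measure Ω)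
    [MeasureTheory.IsProbabilityMeasure P] (Z : ℕ → Ω → ℝ)
    (hindep : ProbabilityTheory.iIndepFun Z P)
    (hlaw : ∀ n, ProbabilityTheory.HasLaw (Z n) (ProbabilityTheory.gaussianReal 0 1) P)
    (a b : ℕ → ℝ) (ha_anti : Antitone a) (hb_anti : Antitone b)
    (ha_pos : ∀ n, 0 < a n) (hb_pos : ∀ n, 0 < b n)
    (ha_sum : Summable a) (hb_sum : Summable b)
    (hab : InfiniteProductConverges
      (fun n => 2 - (a n / l2Norm a) / (b n / l2Norm b)))
    (hba : InfiniteProductConverges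
      (fun n => 2 - (b n / l2Norm b) / (a n / l2Norm a))) :
    (fun r => upperTail P Z a r) ~[Filter.atTop] (fun r => upperTail P Z b r) := by
  have hA := upperTail_isEquivalent hindep hlaw ha_pos ha_sum
  have hB := upperTail_isEquivalent hindep hlaw hb_pos hb_sum
  have hNa := l2Norm_pos ha_pos ha_sum
  have hNb := l2Norm_pos hb_pos hb_sum
  refine (hA.trans ?_).trans hB.symm
  have hα : ∀ n, 0 < a n / l2Norm a := fun n => div_pos (ha_pos n) hNa
  have hβ : ∀ n, 0 < b n / l2Norm b := fun n => div_pos (hb_pos n) hNb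
  obtain ⟨hs1, hs2⟩ := summable_of_infiniteProductConverges
    (c := fun n => (a n / l2Norm a) / (b n / l2Norm b)) (fun n => div_pos (hα n) (hβ n)) hab
    (by simpa only [inv_div] using hba)
  have hS := tendsto_logProdTwoPhi_sub hα hβ (ha_sum.div_const _) (hb_sum.div_const _)
    (fun m n h => div_le_div_of_nonneg_right (hb_anti h) hNb.le) hs1 hs2
  -- The Gaussian prefactors cancel, leaving the exponential of the difference of log-products.
  refine Asymptotics.isEquivalent_of_tendsto_one ?_
  have hE := hS.rexp
  rw [exp_zero] at hE
  refine hE.congr' ?_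
  filter_upwards [eventually_gt_atTop 0] with r hr
  simp only [Pi.div_apply, tailAsymp, add_zero]
  rw [exp_sub, mul_div_mul_left _ _ (by positivity)]
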